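/- Let $\Bbbk$ be a field. A \emph{2-algebra} is a $\Bbbk$-vector space with two unital associative multiplications $\cdot,\diamond$ sharing one unit. A \emph{2-bialgebra} is a coalgebra with a 2-algebra structure whose unit and multiplications are coalgebra maps, and a \emph{2-Hopf algebra} is a 2-bialgebra in which both bialgebra structures have antipodes, $S$ for $\cdot$ and $T$ for $\diamond$. A \emph{Hopf brace} is a 2-Hopf algebra with $x\diamond(y\cdot z)=(x_{(1)}\diamond y)\cdot S(x_{(2)})\cdot(x_{(3)}\diamond z)$ for all $x,y,z$. Morphisms are the coalgebra maps preserving the unit and both multiplications (they automatically preserve antipodes). Write ${}_2\mathrm{Bialg}$, ${}_2\mathrm{Halg}$, $\mathrm{Hbr}$ for the resulting categories, with a superscript $\mathrm{coc}$ for the full subcategories of cocommutative objects. A \emph{Hopf brace ideal} is a coideal that is a Hopf ideal for both Hopf structures. For a subspace $J$ of a 2-Hopf algebra let $J_0=J$ and let $J_{n+1}$ be, for $n$ even, the $\cdot$-ideal generated by $J_n,S(J_n),S^2(J_n),\dots$ and, for $n$ odd, the $\diamond$-ideal generated by $J_n,T(J_n),T^2(J_n),\dots$; put $\widetilde J=\bigcup_n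 J_n$. (1) Coequalizers. Let $f,g\colon A\to B$ be morphisms in $\mathrm{Hbr}$ (respectively in $\mathrm{Hbr}^{coc}$), and let $I_0$ be the span of $\{f(a)-g(a) : a\in A\}$. Then $\widetilde{I_0}$ is a Hopf brace ideal, $B/\widetilde{I_0}$ is an object of $\mathrm{Hbr}$ (respectively $\mathrm{Hbr}^{coc}$), and the projection $B\to B/\widetilde{I_0}$ is the coequalizer of $f$ and $g$ in that category. (2) Coproducts of 2-bialgebras. Let $(B_l)_{l\in I}$ be a family in ${}_2\mathrm{Bialg}$ (respectively ${}_2\mathrm{Bialg}^{coc}$). Let $F$ be the free 2-algebra on the direct-sum coalgebra $\bigoplus_l B_l$, with comultiplication and counit the 2-algebra morphisms extending those of $\bigoplus_l B_l$, and let $u_t\colon B_t\to\bigoplus_l B_l\to F$ be the canonical maps. Let $L_0$ be the span of all $1-u_t(1)$, $u_t(x\cdot x')-u_t(x)\cdot u_t(x')$ and $u_t(x\diamond x')-u_t(x)\diamond u_t(x')$ for $t\in I$ and $x,x'\in B_t$; let $L_{n+1}$ be the ideal generated by $L_n$ for $\cdot$ if $n$ is even and for $\diamond$ if $n$ is odd,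 and let $L=\bigcup_n L_n$. Then $L$ is a coideal and an ideal for both multiplications, and $F/L$, with the maps $B_t\to F\to F/L$, is the coproduct of $(B_l)$ in ${}_2\mathrm{Bialg}$ (respectively ${}_2\mathrm{Bialg}^{coc}$). (3) Coproducts of 2-Hopf algebras. The forgetful functors ${}_2\mathrm{Halg}\to{}_2\mathrm{Bialg}$ and ${}_2\mathrm{Halg}^{coc}\to{}_2\mathrm{Bialg}^{coc}$ have left adjoints. If $(H_l)_{l\in I}$ is a family in ${}_2\mathrm{Halg}$ (respectively ${}_2\mathrm{Halg}^{coc}$), $(B,(q_l))$ is a coproduct of the underlying family in ${}_2\mathrm{Bialg}$ (respectively ${}_2\mathrm{Bialg}^{coc}$), and $i\colon B\to K$ is a universal arrow from $B$ to the forgetful functor, then $K$ with the maps $i\circ q_l$ is the coproduct of $(H_l)$ in ${}_2\mathrm{Halg}$ (respectively ${}_2\mathrm{Halg}^{coc}$). (4) Coproducts of cocommutative Hopf braces. Let $(H_l)_{l\in I}$ be a family in $\mathrm{Hbr}^{coc}$, let $(H,(q_l))$ be a coproduct of it in ${}_2\mathrm{Halg}^{coc}$, and let $J_0\subseteq H$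 be the span of all $$x\diamond(y\cdot z)-(x_{(1)}\diamond y)\cdot S(x_{(2)})\cdot(x_{(3)}\diamond z)$$ with $x,y,z\in H$. Then $\widetilde{J_0}$ is a Hopf brace ideal, $H/\widetilde{J_0}$ is a cocommutative Hopf brace, and with the maps $H_l\to H\to H/\widetilde{J_0}$ it is the coproduct of $(H_l)$ in $\mathrm{Hbr}^{coc}$. If moreover $J_0'\subseteq J_0$ is the span of these elements for $x,y,z\in\bigcup_l q_l(H_l)$ only, then $\widetilde{J_0'}$ is a Hopf brace ideal, $H/\widetilde{J_0'}$ is a cocommutative 2-Hopf algebra, and for every cocommutative Hopf brace $B$ and all morphisms $b_l\colon H_l\to B$ there is a unique morphism of 2-Hopf algebras $w\colon H/\widetilde{J_0'}\to B$ with $w\circ\pi\circ q_l=b_l$ for all $l$, where $\pi\colon H\to H/\widetilde{J_0'}$ is the projection. -/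

import Mathlib

open CategoryTheory CategoryTheory.Limits TensorProduct

universe u v w

noncomputable section

/-! ### 2-algebras, 2-bialgebras, 2-Hopf algebras

The two multiplications are indexed by `Fin 2`: `mul k 0 x y` is the first one, `x · y`, and
`mul k 1 x y` is the second one, `x ⋄ y`. -/

/-- A 2-algebra: a vector space with two unital associative multiplications sharing the same
unit. -/
class TwoAlgebra (k : Type u) (A : Type v) [Field k] [AddCommGroup A] [Module k A] where
  one (k) : A
  mul (k) : Fin 2 → A →ₗ[k] A →ₗ[k] A
  protected one_mul : ∀ i x, mul i one x = x
  protected mul_one : ∀ i x, mul i x one = x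
  protected mul_assoc : ∀ i x y z, mul i (mul i x y) z = mul i x (mul i y z)

/-- A 2-bialgebra: a coalgebra with a 2-algebra structure such that the unit and both
multiplications are coalgebra maps. Here `TensorProduct.map₂ m m` is the multiplication
`(a ⊗ b) (c ⊗ d) = m a c ⊗ m b d`. -/
class TwoBialgebra (k : Type u) (A : Type v) [Field k] [AddCommGroup A] [Module k A]
    [Coalgebra k A] extends TwoAlgebra k A where
  protected counit_one : Coalgebra.counit (R := k) one = 1
  protected counit_mul : ∀ i x y, Coalgebra.counit (R := k) (mul i x y) =
    Coalgebra.counit (R := k) x * Coalgebra.counit (R := k) y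
  protected comul_one : Coalgebra.comul (R := k) one = one ⊗ₜ[k] one
  protected comul_mul : ∀ i x y, Coalgebra.comul (R := k) (mul i x y) =
    TensorProduct.map₂ (mul i) (mul i) (Coalgebra.comul (R := k) x) (Coalgebra.comul (R := k) y)

/-- A 2-Hopf algebra: a 2-bialgebra both of whose bialgebra structures have an antipode.
`antipode k 0` is `S` (for `·`) and `antipode k 1` is `T` (for `⋄`). -/
class TwoHopfAlgebra (k : Type u) (A : Type v) [Field k] [AddCommGroup A] [Module k A]
    [Coalgebra k A] extends TwoBialgebra k A where
  antipode (k) : Fin 2 → A →ₗ[k] A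
  protected antipode_mul_id : ∀ i x,
    TensorProduct.lift (mul i) (TensorProduct.map (antipode i) LinearMap.id
      (Coalgebra.comul (R := k) x)) = Coalgebra.counit (R := k) x • one
  protected id_mul_antipode : ∀ i x,
    TensorProduct.lift (mul i) (TensorProduct.map LinearMap.id (antipode i)
      (Coalgebra.comul (R := k) x)) = Coalgebra.counit (R := k) x • one

open TwoAlgebra TwoHopfAlgebra

/-- `(x₍₁₎ ⋄ y) · S(x₍₂₎) · (x₍₃₎ ⋄ z)`. -/
def hopfBraceRHS (k : Type u) {A : Type v} [Field k] [AddCommGroup A] [Module k A]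
    [Coalgebra k A] [TwoHopfAlgebra k A] (x y z : A) : A :=
  TensorProduct.lift (mul k 0)
    (TensorProduct.map ((mul k 1).flip y)
      (TensorProduct.lift (mul k 0) ∘ₗ
        TensorProduct.map (antipode k 0) ((mul k 1).flip z))
      (LinearMap.lTensor A Coalgebra.comul (Coalgebra.comul (R := k) x)))

/-- A Hopf brace: a 2-Hopf algebra with
`x ⋄ (y · z) = (x₍₁₎ ⋄ y) · S(x₍₂₎) · (x₍₃₎ ⋄ z)`. -/
class IsHopfBrace (k : Type u) (A : Type v) [Field k] [AddCommGroup A] [Module k A]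
    [Coalgebra k A] [TwoHopfAlgebra k A] : Prop where
  brace : ∀ x y z : A, mul k 1 x (mul k 0 y z) = hopfBraceRHS k x y z

/-! ### Morphisms and categories -/

/-- Morphisms of 2-bialgebras: coalgebra maps preserving the unit and both multiplications. -/
structure TwoBialgHom (k : Type u) (A : Type v) (B : Type w) [Field k]
    [AddCommGroup A] [Module k A] [Coalgebra k A] [TwoBialgebra k A]
    [AddCommGroup B] [Module k B] [Coalgebra k B] [TwoBialgebra k B]
    extends A →ₗc[k] B where
  map_one' : toFun (one k) = one k
  map_mul' : ∀ i x y, toFun (mul k i x y) = mul k i (toFun x) (toFun y)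

namespace TwoBialgHom

variable {k : Type u} {A B : Type v} [Field k]
    [AddCommGroup A] [Module k A] [Coalgebra k A] [TwoBialgebra k A]
    [AddCommGroup B] [Module k B] [Coalgebra k B] [TwoBialgebra k B]

instance : FunLike (TwoBialgHom k A B) A B where
  coe f := f.toFun
  coe_injective f g h := by
    cases f; cases g; congr; exact DFunLike.coe_injective h

end TwoBialgHom

/-- The category `₂Bialg` of 2-bialgebras. -/
structure TwoBialg (k : Type u) [Field k] where
  carrier : Type u
  [addCommGroup : AddCommGroup carrier]
  [module : Module k carrier]
  [coalgebra : Coalgebra k carrier]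
  [twoBialgebra : TwoBialgebra k carrier]

attribute [instance] TwoBialg.addCommGroup TwoBialg.module TwoBialg.coalgebra
  TwoBialg.twoBialgebra

instance (k : Type u) [Field k] : Category (TwoBialg k) where
  Hom A B := TwoBialgHom k A.carrier B.carrier
  id A := { CoalgHom.id k A.carrier with
    map_one' := rfl
    map_mul' := fun _ _ _ => rfl }
  comp f g := { g.toCoalgHom.comp f.toCoalgHom with
    map_one' := (congrArg g.toFun f.map_one').trans g.map_one'
    map_mul' := fun i x y => (congrArg g.toFun (f.map_mul' i x y)).trans (g.map_mul' i _ _) }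

instance (k : Type u) [Field k] :
    ConcreteCategory (TwoBialg k) (fun A B => TwoBialgHom k A.carrier B.carrier) where
  hom f := f
  ofHom f := f
  id_apply _ := rfl
  comp_apply _ _ _ := rfl

/-- The category `₂Halg` of 2-Hopf algebras. As usual for Hopf algebras, the morphisms are the
morphisms of the underlying 2-bialgebras; they commute with the antipodes automatically. -/
structure TwoHalg (k : Type u) [Field k] where
  carrier : Type u
  [addCommGroup : AddCommGroup carrier]
  [module : Module k carrier]
  [coalgebra : Coalgebra k carrier]
  [twoHopfAlgebra : TwoHopfAlgebra k carrier]

attribute [instance] TwoHalg.addCommGroup TwoHalg.module TwoHalg.coalgebra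
  TwoHalg.twoHopfAlgebra

/-- The underlying 2-bialgebra. -/
def TwoHalg.toTwoBialg {k : Type u} [Field k] (H : TwoHalg k) : TwoBialg k where
  carrier := H.carrier

instance (k : Type u) [Field k] : Category (TwoHalg k) :=
  inferInstanceAs (Category (InducedCategory (TwoBialg k) TwoHalg.toTwoBialg))

instance (k : Type u) [Field k] :
    ConcreteCategory (TwoHalg k) (fun A B => TwoBialgHom k A.carrier B.carrier) :=
  inferInstanceAs (ConcreteCategory (InducedCategory (TwoBialg k) TwoHalg.toTwoBialg)
    (fun A B => TwoBialgHom k A.toTwoBialg.carrier B.toTwoBialg.carrier))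

/-- The forgetful functor `₂Halg ⥤ ₂Bialg`. -/
def TwoHalg.forget (k : Type u) [Field k] : TwoHalg k ⥤ TwoBialg k :=
  inducedFunctor TwoHalg.toTwoBialg

/-- Cocommutativity of a 2-bialgebra. -/
def TwoBialg.isCocomm (k : Type u) [Field k] : ObjectProperty (TwoBialg k) :=
  fun B => Coalgebra.IsCocomm k B.carrier

/-- Cocommutativity of a 2-Hopf algebra. -/
def TwoHalg.isCocomm (k : Type u) [Field k] : ObjectProperty (TwoHalg k) :=
  fun H => Coalgebra.IsCocomm k H.carrier

/-- The property of being a Hopf brace. -/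
def TwoHalg.isHopfBrace (k : Type u) [Field k] : ObjectProperty (TwoHalg k) :=
  fun H => IsHopfBrace k H.carrier

/-- The category of cocommutative 2-bialgebras. -/
abbrev TwoBialgCoc (k : Type u) [Field k] := (TwoBialg.isCocomm k).FullSubcategory

/-- The category of cocommutative 2-Hopf algebras. -/
abbrev TwoHalgCoc (k : Type u) [Field k] := (TwoHalg.isCocomm k).FullSubcategory

/-- The category `Hbr` of Hopf braces. -/
abbrev Hbr (k : Type u) [Field k] := (TwoHalg.isHopfBrace k).FullSubcategory

/-- The category `Hbr^coc` of cocommutative Hopf braces. -/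
abbrev HbrCoc (k : Type u) [Field k] :=
  (TwoHalg.isHopfBrace k ⊓ TwoHalg.isCocomm k).FullSubcategory

/-- The forgetful functor from cocommutative 2-Hopf algebras to cocommutative 2-bialgebras. -/
def TwoHalgCoc.forget (k : Type u) [Field k] : TwoHalgCoc k ⥤ TwoBialgCoc k :=
  (TwoBialg.isCocomm k).lift ((TwoHalg.isCocomm k).ι ⋙ TwoHalg.forget k) (fun H => H.property)

/-- The inclusion of `Hbr^coc` into the category of cocommutative 2-Hopf algebras. -/
def HbrCoc.incl (k : Type u) [Field k] : HbrCoc k ⥤ TwoHalgCoc k :=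
  ObjectProperty.ιOfLE inf_le_right

/-! ### Ideals and quotients -/

section Ideals

variable (k : Type u) {A : Type v} [Field k] [AddCommGroup A] [Module k A]

/-- The two-sided ideal generated by a set `s` for the `i`-th multiplication. -/
def idealGenerated [TwoAlgebra k A] (i : Fin 2) (s : Set A) : Submodule k A :=
  sInf {L | s ⊆ L ∧ ∀ a, ∀ x ∈ L, mul k i a x ∈ L ∧ mul k i x a ∈ L}

variable {k}

theorem subset_idealGenerated [TwoAlgebra k A] (i : Fin 2) (s : Set A) :
    s ⊆ idealGenerated k i s := fun _ hx =>
  (Submodule.mem_sInf).2 fun _ hL => hL.1 hx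

/-- The chain `J₀ = J`, `Jₙ₊₁ =` the ideal generated by `Jₙ`, for the first multiplication if
`n` is even and for the second one if `n` is odd. -/
def biidealChain [TwoAlgebra k A] (J : Submodule k A) : ℕ → Submodule k A
  | 0 => J
  | n + 1 => idealGenerated k (Fin.ofNat 2 n) (biidealChain J n)

/-- The union of the chain `biidealChain J`. -/
def biidealClosure [TwoAlgebra k A] (J : Submodule k A) : Submodule k A :=
  ⨆ n, biidealChain J n

/-- The chain `J₀ = J`, `Jₙ₊₁ =` the ideal generated by `Jₙ, S(Jₙ), S²(Jₙ), …` for the first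
multiplication (`S` being its antipode) if `n` is even, and the ideal generated by
`Jₙ, T(Jₙ), T²(Jₙ), …` for the second multiplication (`T` being its antipode) if `n` is odd. -/
def hopfIdealChain [Coalgebra k A] [TwoHopfAlgebra k A] (J : Submodule k A) : ℕ → Submodule k A
  | 0 => J
  | n + 1 => idealGenerated k (Fin.ofNat 2 n)
      (⋃ m : ℕ, (antipode k (Fin.ofNat 2 n))^[m] '' (hopfIdealChain J n : Set A))

/-- The union of the chain `hopfIdealChain J`: the Hopf brace ideal generated by `J`. -/
def hopfIdealClosure [Coalgebra k A] [TwoHopfAlgebra k A] (J : Submodule k A) :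
    Submodule k A :=
  ⨆ n, hopfIdealChain J n

theorem mem_biidealClosure [TwoAlgebra k A] (J : Submodule k A) (x : A) :
    x ∈ biidealClosure J ↔ ∃ n, x ∈ biidealChain J n :=
  Submodule.mem_iSup_of_directed _
    (monotone_nat_of_le_succ fun n => subset_idealGenerated (Fin.ofNat 2 n) _).directed_le

theorem mem_hopfIdealClosure [Coalgebra k A] [TwoHopfAlgebra k A] (J : Submodule k A) (x : A) :
    x ∈ hopfIdealClosure J ↔ ∃ n, x ∈ hopfIdealChain J n := by
  have h : Monotone (hopfIdealChain J) := monotone_nat_of_le_succ fun n y hy =>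
    subset_idealGenerated (Fin.ofNat 2 n) _ (Set.mem_iUnion.2 ⟨0, y, hy, rfl⟩)
  exact Submodule.mem_iSup_of_directed _ h.directed_le

/-- A coideal that is a two-sided ideal for both multiplications. -/
structure IsTwoBiideal [Coalgebra k A] [TwoBialgebra k A] (L : Submodule k A) : Prop where
  isCoideal : L.IsCoideal
  mul_left_mem : ∀ (i : Fin 2) (a : A), ∀ x ∈ L, mul k i a x ∈ L
  mul_right_mem : ∀ (i : Fin 2) (a : A), ∀ x ∈ L, mul k i x a ∈ L

/-- A Hopf brace ideal: a coideal that is a Hopf ideal for both Hopf algebra structures. -/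
structure IsHopfBraceIdeal [Coalgebra k A] [TwoHopfAlgebra k A] (L : Submodule k A) : Prop
    extends IsTwoBiideal L where
  antipode_mem : ∀ (i : Fin 2), ∀ x ∈ L, antipode k i x ∈ L

/-- The bilinear map `A ⧸ L → A ⧸ L → A ⧸ L` induced by a bilinear map `m`. -/
def quotientMul (L : Submodule k A) (m : A →ₗ[k] A →ₗ[k] A)
    (hl : ∀ a, ∀ x ∈ L, m a x ∈ L) (hr : ∀ a, ∀ x ∈ L, m x a ∈ L) :
    A ⧸ L →ₗ[k] A ⧸ L →ₗ[k] A ⧸ L :=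
  L.liftQ
    { toFun := fun a => L.mapQ L (m a) (hl a)
      map_add' := fun a b => by ext; simp
      map_smul' := fun c a => by ext; simp }
    (fun x hx => by
      ext a
      simpa using hr a x hx)

@[simp]
theorem quotientMul_mk (L : Submodule k A) (m : A →ₗ[k] A →ₗ[k] A)
    (hl : ∀ a, ∀ x ∈ L, m a x ∈ L) (hr : ∀ a, ∀ x ∈ L, m x a ∈ L) (x y : A) :
    quotientMul L m hl hr (Submodule.Quotient.mk x) (Submodule.Quotient.mk y) =
      Submodule.Quotient.mk (m x y) := rfl

/-- The quotient of a 2-bialgebra by a biideal, with the induced operations. The coalgebra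
structure is Mathlib's structure on the quotient by a coideal. -/
@[reducible]
def IsTwoBiideal.twoBialgebra [Coalgebra k A] [TwoBialgebra k A] {L : Submodule k A}
    (hL : IsTwoBiideal L) :
    letI := hL.isCoideal
    TwoBialgebra k (A ⧸ L) :=
  letI := hL.isCoideal
  { one := L.mkQ (one k)
    mul := fun i => quotientMul L (mul k i) (hL.mul_left_mem i) (hL.mul_right_mem i)
    one_mul := fun i x => by
      obtain ⟨x, rfl⟩ := L.mkQ_surjective x
      simp [TwoAlgebra.one_mul]
    mul_one := fun i x => by
      obtain ⟨x, rfl⟩ := L.mkQ_surjective x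
      simp [TwoAlgebra.mul_one]
    mul_assoc := fun i x y z => by
      obtain ⟨x, rfl⟩ := L.mkQ_surjective x
      obtain ⟨y, rfl⟩ := L.mkQ_surjective y
      obtain ⟨z, rfl⟩ := L.mkQ_surjective z
      simp [TwoAlgebra.mul_assoc]
    counit_one := by
      simp [TwoBialgebra.counit_one]
    counit_mul := fun i x y => by
      obtain ⟨x, rfl⟩ := L.mkQ_surjective x
      obtain ⟨y, rfl⟩ := L.mkQ_surjective y
      simp [TwoBialgebra.counit_mul]
    comul_one := by
      simp [TwoBialgebra.comul_one]
    comul_mul := fun i x y => by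
      obtain ⟨x, rfl⟩ := L.mkQ_surjective x
      obtain ⟨y, rfl⟩ := L.mkQ_surjective y
      simp only [Submodule.mkQ_apply, quotientMul_mk, Coalgebra.Quotient.comul_mk, TwoBialgebra.comul_mul]
      generalize Coalgebra.comul (R := k) x = s
      generalize Coalgebra.comul (R := k) y = t
      induction s using TensorProduct.induction_on with
      | zero => simp
      | add s s' hs hs' => simp [hs, hs']
      | tmul a b =>
        induction t using TensorProduct.induction_on with
        | zero => simp
        | add t t' ht ht' => simp only [map_add, ht, ht']
        | tmul c d => simp }

/-- The quotient of a 2-Hopf algebra by a Hopf brace ideal, with the induced operations. -/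
@[reducible]
def IsHopfBraceIdeal.twoHopfAlgebra [Coalgebra k A] [TwoHopfAlgebra k A] {L : Submodule k A}
    (hL : IsHopfBraceIdeal L) :
    letI := hL.isCoideal
    TwoHopfAlgebra k (A ⧸ L) :=
  letI := hL.isCoideal
  { hL.toIsTwoBiideal.twoBialgebra with
    antipode := fun i => L.mapQ L (antipode k i) (fun x hx => hL.antipode_mem i x hx)
    antipode_mul_id := fun i x => by
      obtain ⟨x, rfl⟩ := L.mkQ_surjective x
      have h := congrArg L.mkQ (TwoHopfAlgebra.antipode_mul_id (k := k) i x)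
      simp only [map_smul] at h
      simp only [Submodule.mkQ_apply, Coalgebra.Quotient.comul_mk,
        Coalgebra.Quotient.counit_mk] at h ⊢
      refine Eq.trans ?_ h
      generalize Coalgebra.comul (R := k) x = s
      induction s using TensorProduct.induction_on with
      | zero => simp
      | add s s' hs hs' => simp only [map_add, hs, hs', Submodule.Quotient.mk_add]
      | tmul a b => rfl
    id_mul_antipode := fun i x => by
      obtain ⟨x, rfl⟩ := L.mkQ_surjective x
      have h := congrArg L.mkQ (TwoHopfAlgebra.id_mul_antipode (k := k) i x)
      simp only [map_smul] at h
      simp only [Submodule.mkQ_apply, Coalgebra.Quotient.comul_mk,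
        Coalgebra.Quotient.counit_mk] at h ⊢
      refine Eq.trans ?_ h
      generalize Coalgebra.comul (R := k) x = s
      induction s using TensorProduct.induction_on with
      | zero => simp
      | add s s' hs hs' => simp only [map_add, hs, hs', Submodule.Quotient.mk_add]
      | tmul a b => rfl }

end Ideals

/-- The quotient 2-bialgebra `B ⧸ L` as an object of `₂Bialg`. -/
def TwoBialg.quotient {k : Type u} [Field k] (B : TwoBialg k) (L : Submodule k B.carrier)
    (hL : IsTwoBiideal L) : TwoBialg k :=
  letI := hL.isCoideal
  letI := hL.twoBialgebra
  { carrier := B.carrier ⧸ L }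

/-- The quotient 2-Hopf algebra `H ⧸ L` as an object of `₂Halg`. -/
def TwoHalg.quotient {k : Type u} [Field k] (H : TwoHalg k) (L : Submodule k H.carrier)
    (hL : IsHopfBraceIdeal L) : TwoHalg k :=
  letI := hL.isCoideal
  letI := hL.twoHopfAlgebra
  { carrier := H.carrier ⧸ L }

/-- The projection `B → B ⧸ L` as a morphism of 2-bialgebras. -/
def TwoBialg.proj {k : Type u} [Field k] (B : TwoBialg k) (L : Submodule k B.carrier)
    (hL : IsTwoBiideal L) : B ⟶ B.quotient L hL :=
  letI := hL.isCoideal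
  letI := hL.twoBialgebra
  show TwoBialgHom k B.carrier (B.carrier ⧸ L) from
  { Coalgebra.Quotient.mkQCoalgHom L with
    map_one' := rfl
    map_mul' := fun _ _ _ => rfl }

/-- The projection `H → H ⧸ L` as a morphism of 2-Hopf algebras. -/
def TwoHalg.proj {k : Type u} [Field k] (H : TwoHalg k) (L : Submodule k H.carrier)
    (hL : IsHopfBraceIdeal L) : H ⟶ H.quotient L hL :=
  InducedCategory.homMk (F := TwoHalg.toTwoBialg)
    (H.toTwoBialg.proj L hL.toIsTwoBiideal)

/-! ### The free 2-algebra on a vector space -/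

namespace FreeTwoAlgebra

/-- Formal expressions in the elements of `V` and the operations of a 2-algebra. -/
inductive Pre (k : Type u) (V : Type v)
  | of (x : V)
  | one
  | add (a b : Pre k V)
  | smul (c : k) (a : Pre k V)
  | mul (i : Fin 2) (a b : Pre k V)

variable (k : Type u) (V : Type v) [Field k] [AddCommGroup V] [Module k V]

/-- The relations making formal expressions into a 2-algebra in which `of` is linear. -/
inductive Rel : Pre k V → Pre k V → Prop
  | of_add (x y : V) : Rel (.of (x + y)) (.add (.of x) (.of y))
  | of_smul (c : k) (x : V) : Rel (.of (c • x)) (.smul c (.of x))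
  | add_comm (a b) : Rel (.add a b) (.add b a)
  | add_assoc (a b c) : Rel (.add (.add a b) c) (.add a (.add b c))
  | zero_add (a) : Rel (.add (.of 0) a) a
  | neg_add (a) : Rel (.add (.smul (-1) a) a) (.of 0)
  | one_smul (a) : Rel (.smul 1 a) a
  | mul_smul (c d : k) (a) : Rel (.smul (c * d) a) (.smul c (.smul d a))
  | smul_add (c : k) (a b) : Rel (.smul c (.add a b)) (.add (.smul c a) (.smul c b))
  | add_smul (c d : k) (a) : Rel (.smul (c + d) a) (.add (.smul c a) (.smul d a))
  | add_mul (i a b c) : Rel (.mul i (.add a b) c) (.add (.mul i a c) (.mul i b c))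
  | mul_add (i a b c) : Rel (.mul i a (.add b c)) (.add (.mul i a b) (.mul i a c))
  | smul_mul (i) (c : k) (a b) : Rel (.mul i (.smul c a) b) (.smul c (.mul i a b))
  | mul_smul' (i) (c : k) (a b) : Rel (.mul i a (.smul c b)) (.smul c (.mul i a b))
  | one_mul (i a) : Rel (.mul i .one a) a
  | mul_one (i a) : Rel (.mul i a .one) a
  | mul_assoc (i a b c) : Rel (.mul i (.mul i a b) c) (.mul i a (.mul i b c))
  | add_left (a a' b) : Rel a a' → Rel (.add a b) (.add a' b)
  | add_right (a b b') : Rel b b' → Rel (.add a b) (.add a b')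
  | smul_right (c : k) (a a') : Rel a a' → Rel (.smul c a) (.smul c a')
  | mul_left (i a a' b) : Rel a a' → Rel (.mul i a b) (.mul i a' b)
  | mul_right (i a b b') : Rel b b' → Rel (.mul i a b) (.mul i a b')

end FreeTwoAlgebra

/-- The free 2-algebra on a vector space `V`. -/
def FreeTwoAlgebra (k : Type u) (V : Type v) [Field k] [AddCommGroup V] [Module k V] :
    Type (max u v) :=
  Quot (FreeTwoAlgebra.Rel k V)

namespace FreeTwoAlgebra

variable {k : Type u} {V : Type v} [Field k] [AddCommGroup V] [Module k V]

instance : Zero (FreeTwoAlgebra k V) := ⟨Quot.mk _ (.of 0)⟩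

instance : Add (FreeTwoAlgebra k V) :=
  ⟨Quot.map₂ .add (fun a _ _ h => .add_right a _ _ h) (fun _ _ b h => .add_left _ _ b h)⟩

instance : SMul k (FreeTwoAlgebra k V) :=
  ⟨fun c => Quot.map (.smul c) (fun _ _ h => .smul_right c _ _ h)⟩

instance : Neg (FreeTwoAlgebra k V) := ⟨fun a => (-1 : k) • a⟩

theorem zero_add_aux (a : FreeTwoAlgebra k V) : 0 + a = a := by
  rcases a with ⟨a⟩; exact Quot.sound (.zero_add a)

theorem add_comm_aux (a b : FreeTwoAlgebra k V) : a + b = b + a := by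
  rcases a with ⟨a⟩; rcases b with ⟨b⟩; exact Quot.sound (.add_comm a b)

instance : AddCommGroup (FreeTwoAlgebra k V) where
  add_assoc := by rintro ⟨a⟩ ⟨b⟩ ⟨c⟩; exact Quot.sound (.add_assoc a b c)
  zero_add := zero_add_aux
  add_zero a := (add_comm_aux a 0).trans (zero_add_aux a)
  add_comm := add_comm_aux
  neg_add_cancel := by rintro ⟨a⟩; exact Quot.sound (.neg_add a)
  nsmul := nsmulRec
  zsmul := zsmulRec

instance : Module k (FreeTwoAlgebra k V) :=
  Module.ofMinimalAxioms
    (by rintro c ⟨a⟩ ⟨b⟩; exact Quot.sound (.smul_add c a b))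
    (by rintro c d ⟨a⟩; exact Quot.sound (.add_smul c d a))
    (by rintro c d ⟨a⟩; exact Quot.sound (.mul_smul c d a))
    (by rintro ⟨a⟩; exact Quot.sound (.one_smul a))

instance : TwoAlgebra k (FreeTwoAlgebra k V) where
  one := Quot.mk _ .one
  mul i := LinearMap.mk₂ k
    (Quot.map₂ (.mul i) (fun a _ _ h => .mul_right i a _ _ h) (fun _ _ b h => .mul_left i _ _ b h))
    (by rintro ⟨a⟩ ⟨b⟩ ⟨c⟩; exact Quot.sound (.add_mul i a b c))
    (by rintro c ⟨a⟩ ⟨b⟩; exact Quot.sound (.smul_mul i c a b))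
    (by rintro ⟨a⟩ ⟨b⟩ ⟨c⟩; exact Quot.sound (.mul_add i a b c))
    (by rintro c ⟨a⟩ ⟨b⟩; exact Quot.sound (.mul_smul' i c a b))
  one_mul := by rintro i ⟨a⟩; exact Quot.sound (.one_mul i a)
  mul_one := by rintro i ⟨a⟩; exact Quot.sound (.mul_one i a)
  mul_assoc := by rintro i ⟨a⟩ ⟨b⟩ ⟨c⟩; exact Quot.sound (.mul_assoc i a b c)

variable (k) in
/-- The canonical linear map `V → F(V)`. -/
def ι : V →ₗ[k] FreeTwoAlgebra k V where
  toFun x := Quot.mk _ (.of x)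
  map_add' x y := Quot.sound (.of_add x y)
  map_smul' c x := Quot.sound (.of_smul c x)

@[elab_as_elim]
theorem induction {P : FreeTwoAlgebra k V → Prop} (of : ∀ x, P (ι k x)) (one : P (one k))
    (add : ∀ a b, P a → P b → P (a + b)) (smul : ∀ (c : k) a, P a → P (c • a))
    (mul : ∀ i a b, P a → P b → P (mul k i a b)) (a : FreeTwoAlgebra k V) : P a := by
  rcases a with ⟨a⟩
  induction a with
  | of x => exact of x
  | one => exact one
  | add a b ha hb => exact add _ _ ha hb
  | smul c a ha => exact smul c _ ha
  | mul i a b ha hb => exact mul i _ _ ha hb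

section Lift

variable {A : Type w} [AddCommGroup A] [Module k A] [TwoAlgebra k A]

/-- Evaluation of formal expressions. -/
def liftPre (f : V →ₗ[k] A) : Pre k V → A
  | .of x => f x
  | .one => one k
  | .add a b => liftPre f a + liftPre f b
  | .smul c a => c • liftPre f a
  | .mul i a b => mul k i (liftPre f a) (liftPre f b)

theorem liftPre_rel (f : V →ₗ[k] A) {a b : Pre k V} (h : Rel k V a b) :
    liftPre f a = liftPre f b := by
  induction h with
  | of_add x y => simp [liftPre]
  | of_smul c x => simp [liftPre]
  | add_comm a b => exact _root_.add_comm _ _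
  | add_assoc a b c => exact _root_.add_assoc _ _ _
  | zero_add a => simp [liftPre]
  | neg_add a => simp [liftPre]
  | one_smul a => simp [liftPre]
  | mul_smul c d a => simp [liftPre, SemigroupAction.mul_smul]
  | smul_add c a b => simp [liftPre]
  | add_smul c d a => simp [liftPre, _root_.add_smul]
  | add_mul i a b c => simp [liftPre]
  | mul_add i a b c => simp [liftPre]
  | smul_mul i c a b => simp [liftPre]
  | mul_smul' i c a b => simp [liftPre]
  | one_mul i a => exact TwoAlgebra.one_mul _ _
  | mul_one i a => exact TwoAlgebra.mul_one _ _
  | mul_assoc i a b c => exact TwoAlgebra.mul_assoc _ _ _ _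
  | add_left a a' b _ ih => simp [liftPre, ih]
  | add_right a b b' _ ih => simp [liftPre, ih]
  | smul_right c a a' _ ih => simp [liftPre, ih]
  | mul_left i a a' b _ ih => simp [liftPre, ih]
  | mul_right i a b b' _ ih => simp [liftPre, ih]

/-- The morphism of 2-algebras `F(V) → A` extending a linear map `V → A`. -/
def lift (f : V →ₗ[k] A) : FreeTwoAlgebra k V →ₗ[k] A where
  toFun := Quot.lift (liftPre f) (fun _ _ h => liftPre_rel f h)
  map_add' := by rintro ⟨a⟩ ⟨b⟩; rfl
  map_smul' := by rintro c ⟨a⟩; rfl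

@[simp] theorem lift_ι (f : V →ₗ[k] A) (x : V) : lift f (ι k x) = f x := rfl

@[simp] theorem lift_one (f : V →ₗ[k] A) : lift f (one k) = one k := rfl

@[simp] theorem lift_mul (f : V →ₗ[k] A) (i : Fin 2) (a b : FreeTwoAlgebra k V) :
    lift f (mul k i a b) = mul k i (lift f a) (lift f b) := by
  rcases a with ⟨a⟩; rcases b with ⟨b⟩; rfl

end Lift

end FreeTwoAlgebra

/-- The base field as a 2-algebra. -/
instance (k : Type u) [Field k] : TwoAlgebra k k where
  one := 1
  mul _ := LinearMap.mul k k
  one_mul _ x := _root_.one_mul x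
  mul_one _ x := _root_.mul_one x
  mul_assoc _ x y z := _root_.mul_assoc x y z

/-- The tensor product of two 2-algebras. -/
instance (k : Type u) (A : Type v) (B : Type w) [Field k] [AddCommGroup A] [Module k A]
    [TwoAlgebra k A] [AddCommGroup B] [Module k B] [TwoAlgebra k B] :
    TwoAlgebra k (A ⊗[k] B) where
  one := one k ⊗ₜ[k] one k
  mul i := TensorProduct.map₂ (mul k i) (mul k i)
  one_mul i x := by
    induction x using TensorProduct.induction_on with
    | zero => simp
    | add s t hs ht => rw [map_add, hs, ht]
    | tmul a b => simp [TwoAlgebra.one_mul]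
  mul_one i x := by
    induction x using TensorProduct.induction_on with
    | zero => simp
    | add s t hs ht => rw [map_add, LinearMap.add_apply, hs, ht]
    | tmul a b => simp [TwoAlgebra.mul_one]
  mul_assoc i x y z := by
    induction x using TensorProduct.induction_on with
    | zero => simp
    | add s t hs ht => simp only [map_add, LinearMap.add_apply, hs, ht]
    | tmul a b =>
      induction y using TensorProduct.induction_on with
      | zero => simp
      | add s t hs ht => simp only [map_add, LinearMap.add_apply, hs, ht]
      | tmul c d =>
        induction z using TensorProduct.induction_on with
        | zero => simp
        | add s t hs ht => simp only [map_add, hs, ht]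
        | tmul e f => simp [TwoAlgebra.mul_assoc]

namespace FreeTwoAlgebra

variable {k : Type u} {V : Type v} [Field k] [AddCommGroup V] [Module k V] [Coalgebra k V]

/-- The comultiplication and the counit of `F(V)` for a coalgebra `V` are the morphisms of
2-algebras with `Δ ∘ ι = (ι ⊗ ι) ∘ Δ` and `ε ∘ ι = ε`. -/
instance : CoalgebraStruct k (FreeTwoAlgebra k V) where
  comul := lift (TensorProduct.map (ι k) (ι k) ∘ₗ Coalgebra.comul)
  counit := lift Coalgebra.counit

theorem comul_ι (x : V) : Coalgebra.comul (R := k) (ι k x) =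
    TensorProduct.map (ι k) (ι k) (Coalgebra.comul (R := k) x) := rfl

theorem counit_ι (x : V) : Coalgebra.counit (R := k) (ι k x) = Coalgebra.counit (R := k) x := rfl

theorem comul_one : Coalgebra.comul (R := k) (one k : FreeTwoAlgebra k V) =
    one k ⊗ₜ[k] one k := rfl

theorem counit_one : Coalgebra.counit (R := k) (one k : FreeTwoAlgebra k V) = 1 := rfl

theorem comul_mul (i : Fin 2) (a b : FreeTwoAlgebra k V) :
    Coalgebra.comul (R := k) (mul k i a b) =
      TensorProduct.map₂ (mul k i) (mul k i) (Coalgebra.comul (R := k) a)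
        (Coalgebra.comul (R := k) b) :=
  lift_mul _ i a b

theorem counit_mul (i : Fin 2) (a b : FreeTwoAlgebra k V) :
    Coalgebra.counit (R := k) (mul k i a b) =
      Coalgebra.counit (R := k) a * Coalgebra.counit (R := k) b :=
  lift_mul _ i a b

section Multiplicative

variable {A B C D : Type*} [AddCommGroup A] [Module k A] [TwoAlgebra k A]
  [AddCommGroup B] [Module k B] [TwoAlgebra k B] [AddCommGroup C] [Module k C] [TwoAlgebra k C]
  [AddCommGroup D] [Module k D] [TwoAlgebra k D]

theorem map_mul_of_mul (f : A →ₗ[k] C) (g : B →ₗ[k] D) (i : Fin 2)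
    (hf : ∀ x y, f (mul k i x y) = mul k i (f x) (f y))
    (hg : ∀ x y, g (mul k i x y) = mul k i (g x) (g y)) (s t : A ⊗[k] B) :
    TensorProduct.map f g (mul k i s t) =
      mul k i (TensorProduct.map f g s) (TensorProduct.map f g t) := by
  induction s using TensorProduct.induction_on with
  | zero => simp
  | add s s' hs hs' => simp only [map_add, LinearMap.add_apply, hs, hs']
  | tmul a b =>
    induction t using TensorProduct.induction_on with
    | zero => simp
    | add t t' ht ht' => simp only [map_add, ht, ht']
    | tmul c d =>
      change TensorProduct.map f g (mul k i a c ⊗ₜ mul k i b d) =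
        mul k i (f a) (f c) ⊗ₜ mul k i (g b) (g d)
      simp [hf, hg]

theorem assoc_mul (i : Fin 2) (s t : (A ⊗[k] B) ⊗[k] C) :
    TensorProduct.assoc k A B C (mul k i s t) =
      mul k i (TensorProduct.assoc k A B C s) (TensorProduct.assoc k A B C t) := by
  induction s using TensorProduct.induction_on with
  | zero => simp
  | add s s' hs hs' => simp only [map_add, LinearMap.add_apply, hs, hs']
  | tmul a b =>
    induction t using TensorProduct.induction_on with
    | zero => simp
    | add t t' ht ht' => simp only [map_add, ht, ht']
    | tmul c d =>
      induction a using TensorProduct.induction_on with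
      | zero => simp
      | add s s' hs hs' =>
        simp only [map_add, TensorProduct.add_tmul, LinearMap.add_apply, hs, hs']
      | tmul a a' =>
        induction c using TensorProduct.induction_on with
        | zero => simp
        | add s s' hs hs' => simp only [map_add, TensorProduct.add_tmul, hs, hs']
        | tmul c c' => rfl

end Multiplicative

instance : Coalgebra k (FreeTwoAlgebra k V) where
  coassoc := by
    ext a
    induction a using induction with
    | of x =>
      have h := congrArg (TensorProduct.map (ι k) (TensorProduct.map (ι k) (ι k)))
        (Coalgebra.coassoc_apply (R := k) x)
      simp only [LinearMap.comp_apply, LinearEquiv.coe_coe, comul_ι]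
      generalize Coalgebra.comul (R := k) x = s at h ⊢
      have h1 : ∀ s : V ⊗[k] V, (TensorProduct.assoc k _ _ _)
          (LinearMap.rTensor (FreeTwoAlgebra k V) Coalgebra.comul
            (TensorProduct.map (ι k) (ι k) s)) =
          TensorProduct.map (ι k) (TensorProduct.map (ι k) (ι k))
            (TensorProduct.assoc k V V V (LinearMap.rTensor V Coalgebra.comul s)) := by
        intro s
        induction s using TensorProduct.induction_on with
        | zero => simp
        | add s t hs ht => simp only [map_add, hs, ht]
        | tmul a b =>
          simp only [TensorProduct.map_tmul, LinearMap.rTensor_tmul, comul_ι]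
          generalize Coalgebra.comul (R := k) a = t
          induction t using TensorProduct.induction_on with
          | zero => simp
          | add s t hs ht => simp only [map_add, TensorProduct.add_tmul, hs, ht]
          | tmul c d => simp
      have h2 : ∀ s : V ⊗[k] V, LinearMap.lTensor (FreeTwoAlgebra k V) Coalgebra.comul
            (TensorProduct.map (ι k) (ι k) s) =
          TensorProduct.map (ι k) (TensorProduct.map (ι k) (ι k))
            (LinearMap.lTensor V Coalgebra.comul s) := by
        intro s
        induction s using TensorProduct.induction_on with
        | zero => simp
        | add s t hs ht => simp only [map_add, hs, ht]
        | tmul a b => simp [comul_ι]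
      rw [h1, h2]
      exact h
    | one => rfl
    | add a b ha hb => rw [map_add, ha, hb, map_add]
    | smul c a ha => rw [map_smul, ha, map_smul]
    | mul i a b ha hb =>
      simp only [LinearMap.comp_apply, LinearEquiv.coe_coe] at ha hb ⊢
      rw [show Coalgebra.comul (R := k) (mul k i a b) =
        mul k i (Coalgebra.comul (R := k) a) (Coalgebra.comul (R := k) b) from comul_mul i a b,
        LinearMap.rTensor_def, LinearMap.lTensor_def,
        map_mul_of_mul _ _ i (comul_mul i) (fun _ _ => rfl),
        map_mul_of_mul _ _ i (fun _ _ => rfl) (comul_mul i), assoc_mul]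
      rw [LinearMap.rTensor_def, LinearMap.lTensor_def] at ha hb
      rw [ha, hb]
  rTensor_counit_comp_comul := by
    ext a
    induction a using induction with
    | of x =>
      have h := congrArg (TensorProduct.map LinearMap.id (ι k))
        (Coalgebra.rTensor_counit_comul (R := k) x)
      simp only [LinearMap.comp_apply, comul_ι]
      have h1 : ∀ s : V ⊗[k] V, LinearMap.rTensor (FreeTwoAlgebra k V) Coalgebra.counit
          (TensorProduct.map (ι k) (ι k) s) =
          TensorProduct.map LinearMap.id (ι k) (LinearMap.rTensor V Coalgebra.counit s) := by
        intro s
        induction s using TensorProduct.induction_on with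
        | zero => simp
        | add s t hs ht => simp only [map_add, hs, ht]
        | tmul a b => simp [counit_ι]
      rw [h1, h]
      rfl
    | one => rfl
    | add a b ha hb => rw [map_add, ha, hb, map_add]
    | smul c a ha => rw [map_smul, ha, map_smul]
    | mul i a b ha hb =>
      simp only [LinearMap.comp_apply] at ha hb ⊢
      rw [LinearMap.rTensor_def] at ha hb ⊢
      rw [show Coalgebra.comul (R := k) (mul k i a b) =
        mul k i (Coalgebra.comul (R := k) a) (Coalgebra.comul (R := k) b) from comul_mul i a b,
        map_mul_of_mul _ _ i (counit_mul i) (fun _ _ => rfl), ha, hb]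
      change (1 * 1 : k) ⊗ₜ[k] mul k i a b = 1 ⊗ₜ[k] mul k i a b
      rw [_root_.mul_one]
  lTensor_counit_comp_comul := by
    ext a
    induction a using induction with
    | of x =>
      have h := congrArg (TensorProduct.map (ι k) LinearMap.id)
        (Coalgebra.lTensor_counit_comul (R := k) x)
      simp only [LinearMap.comp_apply, comul_ι]
      have h1 : ∀ s : V ⊗[k] V, LinearMap.lTensor (FreeTwoAlgebra k V) Coalgebra.counit
          (TensorProduct.map (ι k) (ι k) s) =
          TensorProduct.map (ι k) LinearMap.id (LinearMap.lTensor V Coalgebra.counit s) := by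
        intro s
        induction s using TensorProduct.induction_on with
        | zero => simp
        | add s t hs ht => simp only [map_add, hs, ht]
        | tmul a b => simp [counit_ι]
      rw [h1, h]
      rfl
    | one => rfl
    | add a b ha hb => rw [map_add, ha, hb, map_add]
    | smul c a ha => rw [map_smul, ha, map_smul]
    | mul i a b ha hb =>
      simp only [LinearMap.comp_apply] at ha hb ⊢
      rw [LinearMap.lTensor_def] at ha hb ⊢
      rw [show Coalgebra.comul (R := k) (mul k i a b) =
        mul k i (Coalgebra.comul (R := k) a) (Coalgebra.comul (R := k) b) from comul_mul i a b,
        map_mul_of_mul _ _ i (fun _ _ => rfl) (counit_mul i), ha, hb]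
      change mul k i a b ⊗ₜ[k] (1 * 1 : k) = mul k i a b ⊗ₜ[k] (1 : k)
      rw [_root_.mul_one]

instance : TwoBialgebra k (FreeTwoAlgebra k V) where
  counit_one := counit_one
  counit_mul := counit_mul
  comul_one := comul_one
  comul_mul := comul_mul

end FreeTwoAlgebra

/-! ### The relations defining coequalizers and coproducts -/

/-- The span of all `f a - g a`. -/
def coequalizerRelations {k : Type u} [Field k] {A B : TwoHalg k} (f g : A ⟶ B) :
    Submodule k B.carrier :=
  Submodule.span k (Set.range fun a : A.carrier => (f a - g a : B.carrier))

section Coproduct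

open Classical in
/-- The free 2-bialgebra `F(⨁ₗ Bₗ)` on the direct sum of the coalgebras `Bₗ`. -/
def TwoBialg.freeOnSum {k : Type u} [Field k] {I : Type u} (B : I → TwoBialg k) : TwoBialg k where
  carrier := FreeTwoAlgebra k (Π₀ l, (B l).carrier)

open Classical in
/-- The map `u t : B t → ⨁ₗ Bₗ → F(⨁ₗ Bₗ)`. -/
def TwoBialg.toFreeOnSum {k : Type u} [Field k] {I : Type u} (B : I → TwoBialg k) (t : I) :
    (B t).carrier →ₗ[k] (TwoBialg.freeOnSum B).carrier :=
  FreeTwoAlgebra.ι k ∘ₗ DFinsupp.lsingle (R := k) (M := fun l => (B l).carrier) t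

/-- The span of all `1 - u t 1`, `u t (x · x') - u t x · u t x'` and
`u t (x ⋄ x') - u t x ⋄ u t x'`. -/
def TwoBialg.coproductRelations {k : Type u} [Field k] {I : Type u} (B : I → TwoBialg k) :
    Submodule k (TwoBialg.freeOnSum B).carrier :=
  Submodule.span k
    ({a | ∃ t, a = one k - toFreeOnSum B t (one k)} ∪
      {a | ∃ t, ∃ x x' : (B t).carrier, a = toFreeOnSum B t (mul k 0 x x') -
        mul k 0 (toFreeOnSum B t x) (toFreeOnSum B t x')} ∪
      {a | ∃ t, ∃ x x' : (B t).carrier, a = toFreeOnSum B t (mul k 1 x x') -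
        mul k 1 (toFreeOnSum B t x) (toFreeOnSum B t x')})

/-- The biideal `L` of `F(⨁ₗ Bₗ)` generated by `coproductRelations`. -/
def TwoBialg.coproductIdeal {k : Type u} [Field k] {I : Type u} (B : I → TwoBialg k) :
    Submodule k (TwoBialg.freeOnSum B).carrier :=
  biidealClosure (TwoBialg.coproductRelations B)

end Coproduct

/-- The span of all `x ⋄ (y · z) - (x₍₁₎ ⋄ y) · S(x₍₂₎) · (x₍₃₎ ⋄ z)` for `x y z` in a given
subset `s` of a 2-Hopf algebra. -/
def braceRelations {k : Type u} [Field k] (H : TwoHalg k) (s : Set H.carrier) :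
    Submodule k H.carrier :=
  Submodule.span k {a | ∃ x ∈ s, ∃ y ∈ s, ∃ z ∈ s,
    a = mul k 1 x (mul k 0 y z) - hopfBraceRHS k x y z}

end

/-! All the quotients rest on one observation: if `f` and `g` are coalgebra maps, the range of `f -
g` is a coideal, because `f` and `g` agree after projecting to the quotient (`isCoideal_range_sub`).
Suprema of coideals, images of coideals under an antipode, and ideals generated by coideals are
again coideals, so every term of the two chains is a coideal as soon as the first one is. Both
parities recur in the chain, so its union is stable under both multiplications, and in the Hopf case
under both antipodes (`isTwoBiideal_biidealClosure`, `isHopfBraceIdeal_hopfIdealClosure`). The union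
is also the smallest such subspace containing the relations, and kernels of morphisms are such
subspaces, since morphisms commute with antipodes automatically. This gives the universal properties
of the quotients.

It remains to present each space of relations by differences of coalgebra maps. For coequalizers
this is immediate. For coproducts of 2-bialgebras the relations compare `u_t` composed with the unit
or a product of `B_t` to the unit or product of the free 2-algebra. For the brace relations
cocommutativity enters: it makes the comultiplication and the antipode coalgebra maps, so both sides
of the brace identity are coalgebra maps on a triple tensor product.

The left adjoint to the forgetful functor is built by freely adjoining two linear operators to a
2-bialgebra `B` (`FreeOperatorAlgebra`), extending the comultiplication so that the operators
reverse it, and dividing by the antipode identities imposed on all elements. The central point is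
`isTwoBiideal_antipodeIdeal`: the ideal of these identities is a coideal, because a convolution
inverse of the projection yields, after a flip, one of the projected comultiplication. The
construction preserves cocommutativity. Coproducts then pass along the universal arrow because the
forgetful functors are fully faithful. -/

noncomputable section

open TwoAlgebra TwoHopfAlgebra Coalgebra WithConv

/-! ### Convolution inverses of maps into a tensor square -/

section Conv
variable {R A C : Type*} [CommRing R] [Ring A] [Algebra R A] [AddCommGroup C] [Module R C]
  [Coalgebra R C]

/-- Since `(a ⊗ 1)(1 ⊗ b) = a ⊗ b`, a map of the form `(f ⊗ g) ∘ Δ` is a convolution product of two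
maps, each landing in one tensor factor. Convolution inverses can then be computed one factor at a
time; taking the factors in the opposite order produces the flip. -/
theorem conv_inl_inr (f g : C →ₗ[R] A) :
    toConv ((Algebra.TensorProduct.includeLeft : A →ₐ[R] A ⊗[R] A).toLinearMap ∘ₗ f) *
      toConv ((Algebra.TensorProduct.includeRight : A →ₐ[R] A ⊗[R] A).toLinearMap ∘ₗ g) =
    toConv (TensorProduct.map f g ∘ₗ comul) := by
  ext c
  rw [(ℛ R c).convMul_apply]
  simp [← (ℛ R c).eq]

theorem conv_inr_inl (f g : C →ₗ[R] A) :
    toConv ((Algebra.TensorProduct.includeRight : A →ₐ[R] A ⊗[R] A).toLinearMap ∘ₗ f) *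
      toConv ((Algebra.TensorProduct.includeLeft : A →ₐ[R] A ⊗[R] A).toLinearMap ∘ₗ g) =
    toConv ((TensorProduct.comm R A A).toLinearMap ∘ₗ TensorProduct.map f g ∘ₗ comul) := by
  ext c
  rw [(ℛ R c).convMul_apply]
  simp [← (ℛ R c).eq]

theorem toConv_algHom_comp_mul {B : Type*} [Ring B] [Algebra R B] (h : A →ₐ[R] B)
    {f g : C →ₗ[R] A} (hfg : toConv f * toConv g = 1) :
    toConv (h.toLinearMap ∘ₗ f) * toConv (h.toLinearMap ∘ₗ g) = 1 := by
  have := LinearMap.algHom_comp_convMul_distrib h (toConv f) (toConv g)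
  rw [hfg] at this
  have h2 := congrArg toConv this
  rw [toConv_ofConv] at h2
  refine h2.symm.trans ?_
  ext c
  simp

/-- Writing `ₗ` and `ᵣ` for the two inclusions, the product is `(sᵣ * sₗ) * (fₗ * fᵣ)`, which
telescopes from the inside. Only an algebra structure on the target is used, so the result applies
to quotients that are not yet known to be coalgebras. -/
theorem conv_comm_map_mul_map {s f : C →ₗ[R] A} (h : toConv s * toConv f = 1) :
    toConv ((TensorProduct.comm R A A).toLinearMap ∘ₗ TensorProduct.map s s ∘ₗ comul) *
      toConv (TensorProduct.map f f ∘ₗ comul) = 1 := by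
  rw [← conv_inr_inl, ← conv_inl_inr, mul_assoc,
    ← mul_assoc (toConv (_ ∘ₗ s)) (toConv (_ ∘ₗ f)), toConv_algHom_comp_mul _ h, one_mul,
    toConv_algHom_comp_mul _ h]

theorem conv_map_mul_comm_map {s f : C →ₗ[R] A} (h : toConv f * toConv s = 1) :
    toConv (TensorProduct.map f f ∘ₗ comul) *
      toConv ((TensorProduct.comm R A A).toLinearMap ∘ₗ TensorProduct.map s s ∘ₗ comul) = 1 := by
  rw [← conv_inr_inl, ← conv_inl_inr, mul_assoc, ← mul_assoc (toConv (_ ∘ₗ f)) (toConv (_ ∘ₗ s)),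
    toConv_algHom_comp_mul _ h, one_mul, toConv_algHom_comp_mul _ h]

end Conv

/-! ### Each multiplication of a 2-algebra as an ordinary ring, bialgebra or Hopf algebra structure
-/

namespace TwoAlgebra
variable (k : Type u) (A : Type v) [Field k] [AddCommGroup A] [Module k A]

/-- The ring given by the `i`-th multiplication of a 2-algebra. -/
@[reducible]
def ring [TwoAlgebra k A] (i : Fin 2) : Ring A :=
  { (inferInstance : AddCommGroup A) with
    mul := fun x y => mul k i x y
    one := one k
    left_distrib := fun x y z => map_add _ y z
    right_distrib := fun x y z => LinearMap.map_add₂ _ x y z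
    zero_mul := fun x => LinearMap.map_zero₂ _ x
    mul_zero := fun x => map_zero _
    mul_assoc := fun x y z => TwoAlgebra.mul_assoc i x y z
    one_mul := fun x => TwoAlgebra.one_mul i x
    mul_one := fun x => TwoAlgebra.mul_one i x }

/-- The algebra given by the `i`-th multiplication of a 2-algebra. -/
@[reducible]
def algebra [TwoAlgebra k A] (i : Fin 2) :
    letI := ring k A i
    Algebra k A :=
  letI := ring k A i
  Algebra.ofModule (fun r x y => LinearMap.map_smul₂ (mul k i) r x y)
    (fun r x y => map_smul (mul k i x) r y)

end TwoAlgebra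

namespace TwoBialgebra
variable (k : Type u) (A : Type v) [Field k] [AddCommGroup A] [Module k A]

/-- Links the product of the tensor algebra to `map₂`, so that results on bialgebras and on
convolution carry over to 2-algebras. -/
theorem tensorProduct_mul_eq [TwoAlgebra k A] (i : Fin 2) (s t : A ⊗[k] A) :
    letI := ring k A i
    letI := algebra k A i
    s * t = TensorProduct.map₂ (mul k i) (mul k i) s t := by
  let := ring k A i
  let := algebra k A i
  change s * t = _
  induction s using TensorProduct.induction_on with
  | zero => exact (zero_mul t).trans (LinearMap.map_zero₂ _ t).symm
  | add s s' hs hs' =>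
    exact (add_mul s s' t).trans (by rw [hs, hs']; exact (LinearMap.map_add₂ _ s s' t).symm)
  | tmul a b =>
    induction t using TensorProduct.induction_on with
    | zero => exact (mul_zero _).trans (map_zero _).symm
    | add t t' ht ht' =>
      exact (mul_add _ t t').trans (by rw [ht, ht']; exact (map_add _ t t').symm)
    | tmul c d => exact Algebra.TensorProduct.tmul_mul_tmul a c b d

/-- The bialgebra given by the `i`-th multiplication of a 2-bialgebra. -/
@[reducible]
def bialgebra [Coalgebra k A] [TwoBialgebra k A] (i : Fin 2) :
    letI := ring k A i
    Bialgebra k A :=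
  letI := ring k A i
  letI := algebra k A i
  Bialgebra.mk' k A TwoBialgebra.counit_one (TwoBialgebra.counit_mul i _ _)
    TwoBialgebra.comul_one
    ((TwoBialgebra.comul_mul i _ _).trans (tensorProduct_mul_eq k A i _ _).symm)

end TwoBialgebra

/-- The Hopf algebra given by the `i`-th multiplication of a 2-Hopf algebra. -/
@[reducible]
def TwoHopfAlgebra.hopfAlgebra (k : Type u) (A : Type v) [Field k] [AddCommGroup A] [Module k A]
    [Coalgebra k A] [TwoHopfAlgebra k A] (i : Fin 2) :
    letI := ring k A i
    HopfAlgebra k A :=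
  letI := ring k A i
  letI := TwoBialgebra.bialgebra k A i
  { antipode := TwoHopfAlgebra.antipode k i
    mul_antipode_rTensor_comul := LinearMap.ext fun x =>
      (TwoHopfAlgebra.antipode_mul_id (k := k) i x).trans (Algebra.algebraMap_eq_smul_one _).symm
    mul_antipode_lTensor_comul := LinearMap.ext fun x =>
      (TwoHopfAlgebra.id_mul_antipode (k := k) i x).trans
        (Algebra.algebraMap_eq_smul_one _).symm }

section
variable {k : Type u} {A : Type v} [Field k] [AddCommGroup A] [Module k A] [Coalgebra k A]
  [TwoHopfAlgebra k A]

theorem antipode_mul (i : Fin 2) (x y : A) :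
    antipode k i (mul k i x y) = mul k i (antipode k i y) (antipode k i x) :=
  letI := ring k A i
  letI := hopfAlgebra k A i
  HopfAlgebra.antipode_mul_antidistrib (R := k) x y

theorem counit_antipode (i : Fin 2) (x : A) :
    counit (R := k) (antipode k i x) = counit (R := k) x :=
  letI := ring k A i
  letI := hopfAlgebra k A i
  HopfAlgebra.counit_antipode (R := k) (A := A) x

/-- In the convolution algebra of maps `A → A ⊗ A`, the flipped `(S ⊗ S) ∘ Δ` is a left inverse of
`Δ` and `Δ ∘ S` is a right inverse, so they coincide. -/
theorem comul_antipode (i : Fin 2) (x : A) : comul (R := k) (antipode k i x) =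
    TensorProduct.comm k A A
      (TensorProduct.map (antipode k i) (antipode k i) (comul (R := k) x)) := by
  let := ring k A i
  let := hopfAlgebra k A i
  have h1 := conv_comm_map_mul_map (C := A) (LinearMap.antipode_mul_id (R := k) (C := A))
  have h2 := LinearMap.comul_right_inv (R := k) (C := A)
  rw [TensorProduct.map_id] at h1
  have := left_inv_eq_right_inv h1 h2
  exact (congr($this x)).symm

variable {C : Type w} [AddCommGroup C] [Module k C] [Coalgebra k C]

/-- A left and a right inverse of a linear map for the `i`-th convolution product agree. -/
theorem conv_left_inv_eq_right_inv {A : Type v} [AddCommGroup A] [Module k A]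
    [TwoAlgebra k A] (i : Fin 2) (s f t : C →ₗ[k] A)
    (h1 : ∀ x, lift (mul k i) (map s f (comul (R := k) x)) = counit (R := k) x • one k)
    (h2 : ∀ x, lift (mul k i) (map f t (comul (R := k) x)) = counit (R := k) x • one k) :
    s = t := by
  let := ring k A i
  let := algebra k A i
  have h1' : toConv s * toConv f = 1 := by
    ext x
    exact (h1 x).trans (Algebra.algebraMap_eq_smul_one _).symm
  have h2' : toConv f * toConv t = 1 := by
    ext x
    exact (h2 x).trans (Algebra.algebraMap_eq_smul_one _).symm
  exact toConv_injective (left_inv_eq_right_inv h1' h2')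

/-- `conv_comm_map_mul_map` in the language of 2-algebras. It serves to show that the antipode
relations generate a coideal, where `A` is the quotient, so `A` must not be assumed to be a
coalgebra. -/
theorem conv_comm_map_map_eq {A : Type v} [AddCommGroup A] [Module k A]
    [TwoAlgebra k A] (i : Fin 2) {s f : C →ₗ[k] A}
    (h : ∀ x, lift (mul k i) (map s f (comul (R := k) x)) = counit (R := k) x • one k) (x : C) :
    lift (mul k i : A ⊗[k] A →ₗ[k] A ⊗[k] A →ₗ[k] A ⊗[k] A)
      (map ((TensorProduct.comm k A A).toLinearMap ∘ₗ map s s ∘ₗ comul) (map f f ∘ₗ comul)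
        (comul (R := k) x)) = counit (R := k) x • one k := by
  let := ring k A i
  let := algebra k A i
  have h' : toConv s * toConv f = 1 := by
    ext x
    exact (h x).trans (Algebra.algebraMap_eq_smul_one _).symm
  have h2 := congr($(conv_comm_map_mul_map h') x)
  rw [LinearMap.convOne_apply, Algebra.algebraMap_eq_smul_one, LinearMap.convMul_apply] at h2
  refine Eq.trans ?_ h2
  exact congr($(TensorProduct.ext' fun a b => (TwoBialgebra.tensorProduct_mul_eq k A i a b).symm) _)

theorem conv_map_comm_map_eq {A : Type v} [AddCommGroup A] [Module k A]
    [TwoAlgebra k A] (i : Fin 2) {s f : C →ₗ[k] A}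
    (h : ∀ x, lift (mul k i) (map f s (comul (R := k) x)) = counit (R := k) x • one k) (x : C) :
    lift (mul k i : A ⊗[k] A →ₗ[k] A ⊗[k] A →ₗ[k] A ⊗[k] A)
      (map (map f f ∘ₗ comul) ((TensorProduct.comm k A A).toLinearMap ∘ₗ map s s ∘ₗ comul)
        (comul (R := k) x)) = counit (R := k) x • one k := by
  let := ring k A i
  let := algebra k A i
  have h' : toConv f * toConv s = 1 := by
    ext x
    exact (h x).trans (Algebra.algebraMap_eq_smul_one _).symm
  have h2 := congr($(conv_map_mul_comm_map h') x)
  rw [LinearMap.convOne_apply, Algebra.algebraMap_eq_smul_one, LinearMap.convMul_apply] at h2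
  refine Eq.trans ?_ h2
  exact congr($(TensorProduct.ext' fun a b => (TwoBialgebra.tensorProduct_mul_eq k A i a b).symm) _)

end

/-! ### Constructions of coideals -/

section Coideal
variable {k : Type u} {A : Type v} {C : Type w} [Field k] [AddCommGroup A] [Module k A]
  [Coalgebra k A] [AddCommGroup C] [Module k C] [Coalgebra k C]

theorem Submodule.IsCoideal.map_mkQ_comul_of_le {I J : Submodule k A} (hI : I.IsCoideal)
    (h : I ≤ J) {x : A} (hx : x ∈ I) :
    TensorProduct.map J.mkQ J.mkQ (comul (R := k) x) = 0 := by
  have hJ : J.mkQ = Submodule.factor h ∘ₗ I.mkQ := by ext; rfl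
  rw [hJ, TensorProduct.map_comp, LinearMap.comp_apply, hI.map_mkQ_comul_eq_zero hx, map_zero]

/-- Being a coideal means lying in the kernels of two linear maps, the counit and the
comultiplication followed by the projections. Enlarging the subspace divided out only enlarges the
second kernel, so the condition can be checked on each `J i`. -/
theorem isCoideal_iSup {ι : Sort*} {J : ι → Submodule k A} (h : ∀ i, (J i).IsCoideal) :
    (⨆ i, J i).IsCoideal := by
  have h1 : ⨆ i, J i ≤ LinearMap.ker (counit (R := k) (A := A)) :=
    iSup_le fun i x hx => (h i).counit_eq_zero hx
  have h2 : ⨆ i, J i ≤ LinearMap.ker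
      (TensorProduct.map (⨆ i, J i).mkQ (⨆ i, J i).mkQ ∘ₗ comul (R := k)) :=
    iSup_le fun i x hx => (h i).map_mkQ_comul_of_le (le_iSup J i) hx
  exact ⟨fun x hx => h1 hx, fun x hx => h2 hx⟩

/-- With `π` the projection modulo the range, `π ∘ f = π ∘ g`, so the projected comultiplications of
`f x` and `g x` are the image of `Δ x` under the same map. All the coideals of relations below come
from this one. -/
theorem isCoideal_range_sub (f g : C →ₗc[k] A) :
    (LinearMap.range (f.toLinearMap - g.toLinearMap)).IsCoideal := by
  set D := LinearMap.range (f.toLinearMap - g.toLinearMap)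
  have hD : D.mkQ ∘ₗ f.toLinearMap = D.mkQ ∘ₗ g.toLinearMap := by
    ext x
    exact (Submodule.Quotient.eq D).2 ⟨x, rfl⟩
  constructor
  · rintro _ ⟨x, rfl⟩
    have hf := congr($f.counit_comp x)
    have hg := congr($g.counit_comp x)
    rw [LinearMap.comp_apply] at hf hg
    rw [LinearMap.sub_apply, map_sub, hf, hg, sub_self]
  · rintro _ ⟨x, rfl⟩
    have hf := congr($f.map_comp_comul x)
    have hg := congr($g.map_comp_comul x)
    rw [LinearMap.comp_apply, LinearMap.comp_apply] at hf hg
    rw [LinearMap.sub_apply, map_sub, map_sub, ← hf, ← hg, TensorProduct.map_map,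
      TensorProduct.map_map, hD, sub_self]

/-- The antipode reverses the comultiplication, and its composite with the projection modulo its
image of `I` factors through the quotient by `I`. The flip does no harm, as it sends zero to zero.
-/
theorem isCoideal_map_antipode [TwoHopfAlgebra k A] (i : Fin 2) {I : Submodule k A}
    (hI : I.IsCoideal) : (I.map (antipode k i)).IsCoideal := by
  set J := I.map (antipode k i)
  have hJ : J.mkQ ∘ₗ antipode k i =
      I.mapQ J (antipode k i) (Submodule.le_comap_map _ _) ∘ₗ I.mkQ := by ext; rfl
  constructor
  · rintro _ ⟨x, hx, rfl⟩
    rw [counit_antipode, hI.counit_eq_zero hx]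
  · rintro _ ⟨x, hx, rfl⟩
    rw [comul_antipode, TensorProduct.map_comm, TensorProduct.map_map, hJ, TensorProduct.map_comp,
      LinearMap.comp_apply, hI.map_mkQ_comul_eq_zero hx, map_zero, map_zero]

end Coideal

/-! ### Generated ideals and the unions of the alternating chains -/

section Ideal

variable {k : Type u} {A : Type v} [Field k] [AddCommGroup A] [Module k A]

section TwoAlgebra
variable [TwoAlgebra k A]

theorem mul_mem_idealGenerated (i : Fin 2) (s : Set A) (a : A) {x : A}
    (hx : x ∈ idealGenerated k i s) :
    mul k i a x ∈ idealGenerated k i s ∧ mul k i x a ∈ idealGenerated k i s :=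
  ⟨Submodule.mem_sInf.2 fun L hL => (hL.2 a x (Submodule.mem_sInf.1 hx L hL)).1,
    Submodule.mem_sInf.2 fun L hL => (hL.2 a x (Submodule.mem_sInf.1 hx L hL)).2⟩

theorem idealGenerated_le {i : Fin 2} {s : Set A} {L : Submodule k A} (hs : s ⊆ L)
    (hL : ∀ a, ∀ x ∈ L, mul k i a x ∈ L ∧ mul k i x a ∈ L) : idealGenerated k i s ≤ L :=
  sInf_le ⟨hs, hL⟩

end TwoAlgebra

theorem map_mkQ_map₂ {L : Submodule k A} {m : A →ₗ[k] A →ₗ[k] A} (hl : ∀ a, ∀ x ∈ L, m a x ∈ L)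
    (hr : ∀ a, ∀ x ∈ L, m x a ∈ L) (s t : A ⊗[k] A) :
    TensorProduct.map L.mkQ L.mkQ (TensorProduct.map₂ m m s t) =
      TensorProduct.map₂ (quotientMul L m hl hr) (quotientMul L m hl hr)
        (TensorProduct.map L.mkQ L.mkQ s) (TensorProduct.map L.mkQ L.mkQ t) := by
  induction s using TensorProduct.induction_on with
  | zero => simp
  | add s s' hs hs' => simp only [map_add, LinearMap.add_apply, hs, hs']
  | tmul a b =>
    induction t using TensorProduct.induction_on with
    | zero => simp
    | add t t' ht ht' => simp only [map_add, ht, ht']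
    | tmul c d => simp

/-- The counit is multiplicative, and so is the comultiplication followed by the projections modulo
`L`, as `L` is an ideal for the `i`-th product. Both kernels are therefore ideals; they contain `J`,
hence all of `L`. -/
theorem isCoideal_idealGenerated [Coalgebra k A] [TwoBialgebra k A] (i : Fin 2)
    {J : Submodule k A} (hJ : J.IsCoideal) : (idealGenerated k i (J : Set A)).IsCoideal := by
  set L := idealGenerated k i (J : Set A)
  have hl : ∀ a, ∀ x ∈ L, mul k i a x ∈ L := fun a x hx => (mul_mem_idealGenerated i _ a hx).1
  have hr : ∀ a, ∀ x ∈ L, mul k i x a ∈ L := fun a x hx => (mul_mem_idealGenerated i _ a hx).2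
  have h1 : L ≤ LinearMap.ker (counit (R := k) (A := A)) := by
    refine idealGenerated_le (fun x hx => hJ.counit_eq_zero hx) fun a x hx => ?_
    rw [LinearMap.mem_ker] at hx
    simp [TwoBialgebra.counit_mul, hx]
  have h2 : L ≤ LinearMap.ker (TensorProduct.map L.mkQ L.mkQ ∘ₗ comul (R := k)) := by
    refine idealGenerated_le
      (fun x hx => hJ.map_mkQ_comul_of_le (subset_idealGenerated (k := k) i _) hx) fun a x hx => ?_
    rw [LinearMap.mem_ker, LinearMap.comp_apply] at hx
    simp only [LinearMap.mem_ker, LinearMap.comp_apply, TwoBialgebra.comul_mul,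
      map_mkQ_map₂ hl hr, hx, map_zero, LinearMap.zero_apply, and_self]
  exact ⟨fun x hx => h1 hx, fun x hx => h2 hx⟩

/-- Each multiplication is used arbitrarily late in the chain, so an element of any term lies in a
later term that is about to be closed under the prescribed multiplication. -/
theorem exists_le_fin_ofNat_eq (i : Fin 2) (n : ℕ) : ∃ m, n ≤ m ∧ Fin.ofNat 2 m = i := by
  refine ⟨2 * n + i, by omega, ?_⟩
  ext
  simp [Fin.ofNat]
  omega

theorem biidealChain_mono [TwoAlgebra k A] (J : Submodule k A) : Monotone (biidealChain J) :=
  monotone_nat_of_le_succ fun n => subset_idealGenerated (Fin.ofNat 2 n) _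

theorem isTwoBiideal_biidealClosure [Coalgebra k A] [TwoBialgebra k A] {J : Submodule k A}
    (hJ : J.IsCoideal) : IsTwoBiideal (biidealClosure J) := by
  have h : ∀ (i : Fin 2) (a : A), ∀ x ∈ biidealClosure J,
      mul k i a x ∈ biidealClosure J ∧ mul k i x a ∈ biidealClosure J := by
    intro i a x hx
    obtain ⟨n, hn⟩ := (mem_biidealClosure J x).1 hx
    obtain ⟨m, hm, rfl⟩ := exists_le_fin_ofNat_eq i n
    have := mul_mem_idealGenerated (k := k) (Fin.ofNat 2 m) _ a
      (subset_idealGenerated (k := k) (Fin.ofNat 2 m) _ (biidealChain_mono J hm hn))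
    exact ⟨(mem_biidealClosure J _).2 ⟨m + 1, this.1⟩, (mem_biidealClosure J _).2 ⟨m + 1, this.2⟩⟩
  refine ⟨isCoideal_iSup fun n => ?_, fun i a x hx => (h i a x hx).1,
    fun i a x hx => (h i a x hx).2⟩
  induction n with
  | zero => exact hJ
  | succ n ih => exact isCoideal_idealGenerated _ ih

theorem le_biidealClosure [TwoAlgebra k A] (J : Submodule k A) : J ≤ biidealClosure J :=
  le_iSup (biidealChain J) 0

theorem biidealClosure_le [TwoAlgebra k A] {J L : Submodule k A} (hJ : J ≤ L)
    (hL : ∀ (i : Fin 2) (a : A), ∀ x ∈ L, mul k i a x ∈ L ∧ mul k i x a ∈ L) :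
    biidealClosure J ≤ L := by
  refine iSup_le fun n => ?_
  induction n with
  | zero => exact hJ
  | succ n ih => exact idealGenerated_le ih (hL _)

section Hopf
variable [Coalgebra k A] [TwoHopfAlgebra k A]

theorem hopfIdealChain_mono (J : Submodule k A) : Monotone (hopfIdealChain J) :=
  monotone_nat_of_le_succ fun n y hy =>
    subset_idealGenerated (Fin.ofNat 2 n) _ (Set.mem_iUnion.2 ⟨0, y, hy, rfl⟩)

/-- Replaces the union of the iterated images, which is only a set, by their sum as subspaces, to
which the results on coideals apply. -/
theorem hopfIdealChain_succ (J : Submodule k A) (n : ℕ) : hopfIdealChain J (n + 1) =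
    idealGenerated k (Fin.ofNat 2 n) ((⨆ m : ℕ, (hopfIdealChain J n).map
      ((antipode k (Fin.ofNat 2 n)) ^ m) : Submodule k A) : Set A) := by
  apply le_antisymm
  · refine idealGenerated_le (Set.iUnion_subset fun m => ?_) fun a x hx =>
      mul_mem_idealGenerated _ _ a hx
    rintro _ ⟨x, hx, rfl⟩
    refine subset_idealGenerated (k := k) _ _ (Submodule.mem_iSup_of_mem m ⟨x, hx, ?_⟩)
    rw [Module.End.coe_pow]
  · refine idealGenerated_le (SetLike.coe_subset_coe.2 (iSup_le fun m => ?_)) fun a x hx =>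
      mul_mem_idealGenerated _ _ a hx
    rintro _ ⟨x, hx, rfl⟩
    refine subset_idealGenerated (k := k) _ _ (Set.mem_iUnion.2 ⟨m, x, hx, ?_⟩)
    rw [Module.End.coe_pow]

theorem isCoideal_hopfIdealChain {J : Submodule k A} (hJ : J.IsCoideal) (n : ℕ) :
    (hopfIdealChain J n).IsCoideal := by
  induction n with
  | zero => exact hJ
  | succ n ih =>
    rw [hopfIdealChain_succ]
    refine isCoideal_idealGenerated _ (isCoideal_iSup fun m => ?_)
    induction m with
    | zero => rwa [pow_zero, Module.End.one_eq_id, Submodule.map_id]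
    | succ m ihm =>
      rw [pow_succ', Module.End.mul_eq_comp, Submodule.map_comp]
      exact isCoideal_map_antipode _ ihm

/-- The generators are permuted forward by the antipode, which sends the `m`-th iterate to the next
one. As the antipode is antimultiplicative, the elements of the ideal whose antipode stays in it
form an ideal, so it is everything. -/
theorem antipode_mem_hopfIdealChain_succ (J : Submodule k A) (n : ℕ) {x : A}
    (hx : x ∈ hopfIdealChain J (n + 1)) :
    antipode k (Fin.ofNat 2 n) x ∈ hopfIdealChain J (n + 1) := by
  have : hopfIdealChain J (n + 1) ≤ (hopfIdealChain J (n + 1)).comap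
      (antipode k (Fin.ofNat 2 n)) ⊓ hopfIdealChain J (n + 1) := by
    refine idealGenerated_le (Set.iUnion_subset fun m => ?_) fun a x hx => ?_
    · rintro _ ⟨x, hx, rfl⟩
      refine ⟨subset_idealGenerated (k := k) _ _ (Set.mem_iUnion.2 ⟨m + 1, x, hx, ?_⟩),
        subset_idealGenerated (k := k) _ _ (Set.mem_iUnion.2 ⟨m, x, hx, rfl⟩)⟩
      rw [Function.iterate_succ_apply']
    · have h1 := mul_mem_idealGenerated (Fin.ofNat 2 n) _ (antipode k (Fin.ofNat 2 n) a) hx.1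
      have h2 := mul_mem_idealGenerated (Fin.ofNat 2 n) _ a hx.2
      refine ⟨⟨?_, h2.1⟩, ?_, h2.2⟩
      · rw [SetLike.mem_coe, Submodule.mem_comap, antipode_mul]
        exact h1.2
      · rw [SetLike.mem_coe, Submodule.mem_comap, antipode_mul]
        exact h1.1
  exact (this hx).1

theorem isHopfBraceIdeal_hopfIdealClosure {J : Submodule k A} (hJ : J.IsCoideal) :
    IsHopfBraceIdeal (hopfIdealClosure J) := by
  have h : ∀ (i : Fin 2) (x : A), x ∈ hopfIdealClosure J →
      antipode k i x ∈ hopfIdealClosure J ∧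
      ∀ a, mul k i a x ∈ hopfIdealClosure J ∧ mul k i x a ∈ hopfIdealClosure J := by
    intro i x hx
    obtain ⟨n, hn⟩ := (mem_hopfIdealClosure J x).1 hx
    obtain ⟨m, hm, rfl⟩ := exists_le_fin_ofNat_eq i n
    have hx' := hopfIdealChain_mono J (hm.trans m.le_succ) hn
    have := fun a => mul_mem_idealGenerated (k := k) (Fin.ofNat 2 m) _ a hx'
    simp only [mem_hopfIdealClosure]
    exact ⟨⟨m + 1, antipode_mem_hopfIdealChain_succ J m hx'⟩,
      fun a => ⟨⟨m + 1, (this a).1⟩, ⟨m + 1, (this a).2⟩⟩⟩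
  exact
    { isCoideal := isCoideal_iSup (isCoideal_hopfIdealChain hJ)
      mul_left_mem := fun i a x hx => ((h i x hx).2 a).1
      mul_right_mem := fun i a x hx => ((h i x hx).2 a).2
      antipode_mem := fun i x hx => (h i x hx).1 }

theorem le_hopfIdealClosure (J : Submodule k A) : J ≤ hopfIdealClosure J :=
  le_iSup (hopfIdealChain J) 0

theorem hopfIdealClosure_le {J L : Submodule k A} (hJ : J ≤ L)
    (hL : ∀ (i : Fin 2) (a : A), ∀ x ∈ L, mul k i a x ∈ L ∧ mul k i x a ∈ L)
    (hS : ∀ (i : Fin 2), ∀ x ∈ L, antipode k i x ∈ L) :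
    hopfIdealClosure J ≤ L := by
  refine iSup_le fun n => ?_
  induction n with
  | zero => exact hJ
  | succ n ih =>
    refine idealGenerated_le (Set.iUnion_subset fun m => ?_) (hL _)
    rintro _ ⟨x, hx, rfl⟩
    induction m with
    | zero => exact ih hx
    | succ m ihm =>
      rw [Function.iterate_succ_apply']
      exact hS _ _ ihm

end Hopf

end Ideal

/-! ### Morphisms of 2-bialgebras and what they preserve -/

namespace TwoBialgHom

section
variable {k : Type u} {A B : Type v} [Field k]
    [AddCommGroup A] [Module k A] [Coalgebra k A] [TwoBialgebra k A]
    [AddCommGroup B] [Module k B] [Coalgebra k B] [TwoBialgebra k B]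
    (f : TwoBialgHom k A B)

/-- The underlying linear map. -/
abbrev lin : A →ₗ[k] B := f.toCoalgHom.toLinearMap

@[simp] theorem lin_apply (x : A) : f.lin x = f x := rfl

theorem map_one : f (one k) = one k := f.map_one'

theorem map_mul (i : Fin 2) (x y : A) : f (mul k i x y) = mul k i (f x) (f y) :=
  f.map_mul' i x y

theorem counit_apply (x : A) : counit (R := k) (f x) = counit (R := k) x := congr($f.counit_comp x)

theorem comul_apply (x : A) : comul (R := k) (f x) = map f.lin f.lin (comul (R := k) x) :=
  congr($f.map_comp_comul x).symm

@[ext] theorem ext {f g : TwoBialgHom k A B} (h : ∀ x, f x = g x) : f = g := DFunLike.ext _ _ h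

theorem lift_map_comp {C D : Type*} [AddCommGroup C] [Module k C] [AddCommGroup D] [Module k D]
    (i : Fin 2) (p : C →ₗ[k] A) (q : D →ₗ[k] A) (t : C ⊗[k] D) :
    f (lift (mul k i) (map p q t)) = lift (mul k i) (map (f.lin ∘ₗ p) (f.lin ∘ₗ q) t) := by
  change f.lin _ = _
  induction t using TensorProduct.induction_on with
  | zero => simp
  | add s s' hs hs' => simp only [map_add, hs, hs']
  | tmul a b => exact f.map_mul i _ _

end

section
variable {k : Type u} {A B : Type v} [Field k]
    [AddCommGroup A] [Module k A] [Coalgebra k A] [TwoHopfAlgebra k A]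
    [AddCommGroup B] [Module k B] [Coalgebra k B] [TwoHopfAlgebra k B]
    (f : TwoBialgHom k A B)

/-- Morphisms of 2-bialgebras between 2-Hopf algebras commute with the antipodes. -/
theorem map_antipode (i : Fin 2) (x : A) : f (antipode k i x) = antipode k i (f x) := by
  -- Composing `f` with the antipode of the source gives a left convolution inverse of `f`, and with
  -- the antipode of the target a right one.
  refine congr($(conv_left_inv_eq_right_inv i (f.lin ∘ₗ antipode k i) f.lin
    (antipode k i ∘ₗ f.lin) (fun x => ?_) fun x => ?_) x)
  · have := congrArg f (TwoHopfAlgebra.antipode_mul_id (k := k) i x)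
    rw [lift_map_comp] at this
    refine this.trans ?_
    change f.lin _ = _
    rw [map_smul]
    exact congrArg _ f.map_one
  · have := TwoHopfAlgebra.id_mul_antipode (k := k) i (f x)
    rwa [comul_apply, counit_apply, TensorProduct.map_map] at this

theorem map_hopfBraceRHS (x y z : A) :
    f (hopfBraceRHS k x y z) = hopfBraceRHS k (f x) (f y) (f z) := by
  unfold hopfBraceRHS
  rw [lift_map_comp, comul_apply, LinearMap.lTensor_def, LinearMap.lTensor_def,
    TensorProduct.map_map,
    TensorProduct.map_map, TensorProduct.map_map]
  congr 2
  congr 1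
  · ext a
    exact f.map_mul 1 a y
  · ext a
    simp only [LinearMap.comp_apply, lin_apply, comul_apply]
    rw [lift_map_comp, TensorProduct.map_map]
    congr 2
    congr 1
    · ext b
      exact f.map_antipode 0 b
    · ext b
      exact f.map_mul 1 b z

theorem isHopfBrace_of_surjective [IsHopfBrace k A] (hf : Function.Surjective f) :
    IsHopfBrace k B where
  brace x y z := by
    obtain ⟨x, rfl⟩ := hf x
    obtain ⟨y, rfl⟩ := hf y
    obtain ⟨z, rfl⟩ := hf z
    rw [← map_hopfBraceRHS, ← map_mul, ← map_mul, IsHopfBrace.brace]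

end

section
variable {k : Type u} {A B : Type v} [Field k]
    [AddCommGroup A] [Module k A] [Coalgebra k A] [TwoBialgebra k A]
    [AddCommGroup B] [Module k B] [Coalgebra k B] [TwoBialgebra k B]

theorem isCocomm_of_surjective (f : TwoBialgHom k A B) [IsCocomm k A]
    (hf : Function.Surjective f) : IsCocomm k B where
  comm_comp_comul := by
    ext x
    obtain ⟨x, rfl⟩ := hf x
    change TensorProduct.comm k B B (comul (f x)) = comul (f x)
    rw [comul_apply, ← TensorProduct.map_comm, comm_comul]

end

section
variable {k : Type u} {A B : Type v} [Field k]
    [AddCommGroup A] [Module k A] [Coalgebra k A] [TwoBialgebra k A]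
    [AddCommGroup B] [Module k B] [Coalgebra k B] [TwoBialgebra k B]

/-- The morphism `A ⧸ L → B` induced by a morphism `A → B` that vanishes on `L`. -/
@[reducible]
def quotientLift {L : Submodule k A} (hL : IsTwoBiideal L) (f : TwoBialgHom k A B)
    (h : L ≤ LinearMap.ker f.lin) :
    letI := hL.isCoideal
    letI := hL.twoBialgebra
    TwoBialgHom k (A ⧸ L) B :=
  letI := hL.isCoideal
  letI := hL.twoBialgebra
  { toLinearMap := L.liftQ f.lin h
    counit_comp := Submodule.linearMap_qext _ (LinearMap.ext fun x => f.counit_apply x)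
    map_comp_comul := by
      refine Submodule.linearMap_qext _ (LinearMap.ext fun x => ?_)
      refine Eq.trans ?_ (f.comul_apply x).symm
      simp only [LinearMap.comp_apply, Submodule.mkQ_apply, Coalgebra.Quotient.comul_mk]
      rw [TensorProduct.map_map, Submodule.liftQ_mkQ]
    map_one' := f.map_one
    map_mul' := fun i x y => by
      obtain ⟨x, rfl⟩ := L.mkQ_surjective x
      obtain ⟨y, rfl⟩ := L.mkQ_surjective y
      exact f.map_mul i x y }

end

end TwoBialgHom

/-! ### Universal properties of the quotient objects -/

section Categories

variable {k : Type u} [Field k]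

namespace TwoBialg

variable {B C : TwoBialg k} (L : Submodule k B.carrier) (hL : IsTwoBiideal L)

theorem proj_surjective : Function.Surjective (B.proj L hL) := L.mkQ_surjective

/-- The morphism `B ⧸ L ⟶ C` induced by a morphism `B ⟶ C` that vanishes on `L`. -/
def desc (f : B ⟶ C) (h : ∀ x ∈ L, f x = 0) : B.quotient L hL ⟶ C :=
  TwoBialgHom.quotientLift hL (ConcreteCategory.hom f) h

theorem proj_desc (f : B ⟶ C) (h : ∀ x ∈ L, f x = 0) : B.proj L hL ≫ desc L hL f h = f := rfl

theorem quotient_hom_ext {f g : B.quotient L hL ⟶ C} (h : B.proj L hL ≫ f = B.proj L hL ≫ g) :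
    f = g := by
  refine TwoBialgHom.ext fun x => ?_
  obtain ⟨x, rfl⟩ := proj_surjective L hL x
  exact congr($h x)

theorem isCocomm_quotient (hB : isCocomm k B) : isCocomm k (B.quotient L hL) :=
  have : IsCocomm k B.carrier := hB
  TwoBialgHom.isCocomm_of_surjective (B.proj L hL) (proj_surjective L hL)

end TwoBialg

namespace TwoHalg

/-- The underlying morphism of 2-bialgebras. -/
abbrev bialgHom {B C : TwoHalg k} (f : B ⟶ C) : TwoBialgHom k B.carrier C.carrier := f.hom

variable {B C : TwoHalg k} (L : Submodule k B.carrier) (hL : IsHopfBraceIdeal L)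

theorem proj_surjective : Function.Surjective (B.proj L hL) := L.mkQ_surjective

/-- The morphism `B ⧸ L ⟶ C` induced by a morphism `B ⟶ C` that vanishes on `L`. -/
def desc (f : B ⟶ C) (h : ∀ x ∈ L, f x = 0) : B.quotient L hL ⟶ C :=
  InducedCategory.homMk (F := TwoHalg.toTwoBialg)
    (TwoBialg.desc (B := B.toTwoBialg) L hL.toIsTwoBiideal f.hom h)

theorem proj_desc (f : B ⟶ C) (h : ∀ x ∈ L, f x = 0) : B.proj L hL ≫ desc L hL f h = f := rfl

theorem quotient_hom_ext {f g : B.quotient L hL ⟶ C} (h : B.proj L hL ≫ f = B.proj L hL ≫ g) :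
    f = g :=
  InducedCategory.hom_ext (TwoBialg.quotient_hom_ext (B := B.toTwoBialg) L hL.toIsTwoBiideal
    congr(($h).hom))

theorem isCocomm_quotient (hB : isCocomm k B) : isCocomm k (B.quotient L hL) :=
  TwoBialg.isCocomm_quotient (B := B.toTwoBialg) L hL.toIsTwoBiideal hB

theorem isHopfBrace_quotient (hB : isHopfBrace k B) : isHopfBrace k (B.quotient L hL) :=
  have : IsHopfBrace k B.carrier := hB
  TwoBialgHom.isHopfBrace_of_surjective (bialgHom (B.proj L hL)) (proj_surjective L hL)

/-- The kernel of a morphism is stable under both products and, by `map_antipode`, under both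
antipodes. To factor a morphism through the quotient it thus suffices to check the original
relations. -/
theorem hopfIdealClosure_le_ker (f : B ⟶ C) {J : Submodule k B.carrier} (h : ∀ x ∈ J, f x = 0)
    {x : B.carrier} (hx : x ∈ hopfIdealClosure J) : f x = 0 := by
  have : hopfIdealClosure J ≤ LinearMap.ker (bialgHom f).lin := by
    refine hopfIdealClosure_le h (fun i a x hx => ?_) fun i x hx => ?_
    · rw [LinearMap.mem_ker, TwoBialgHom.lin_apply] at hx
      simp only [LinearMap.mem_ker, TwoBialgHom.lin_apply, TwoBialgHom.map_mul, hx, map_zero,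
        LinearMap.zero_apply, and_self]
    · rw [LinearMap.mem_ker, TwoBialgHom.lin_apply] at hx
      rw [LinearMap.mem_ker, TwoBialgHom.lin_apply, TwoBialgHom.map_antipode, hx, map_zero]
  exact this hx

end TwoHalg

end Categories

/-! ### Brace relations in a cocommutative 2-Hopf algebra span a coideal -/

section Brace

section
variable {k A B C D : Type*} [Field k] [AddCommGroup A] [Module k A] [Coalgebra k A]
  [AddCommGroup B] [Module k B] [Coalgebra k B] [AddCommGroup C] [Module k C] [Coalgebra k C]
  [AddCommGroup D] [Module k D] [Coalgebra k D]

variable (k A B C D) in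
/-- The interchange of the two middle factors as a morphism of coalgebras. -/
def tensorTensorTensorCommCoalgHom : (A ⊗[k] B) ⊗[k] (C ⊗[k] D) →ₗc[k] (A ⊗[k] C) ⊗[k] (B ⊗[k] D) :=
  { (TensorProduct.tensorTensorTensorComm k A B C D).toLinearMap with
    counit_comp := by
      ext a b c d
      simp
      ring
    map_comp_comul := by
      ext a b c d
      simp only [AlgebraTensorModule.curry_apply, LinearMap.restrictScalars_self, curry_apply,
        LinearMap.comp_apply, LinearEquiv.coe_coe, comul_tmul,
        AlgebraTensorModule.tensorTensorTensorComm_eq, tensorTensorTensorComm_tmul]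
      hopf_tensor_induction comul (R := k) a with a₁ a₂
      hopf_tensor_induction comul (R := k) b with b₁ b₂
      hopf_tensor_induction comul (R := k) c with c₁ c₂
      hopf_tensor_induction comul (R := k) d with d₁ d₂
      rfl }

end

variable {k : Type u} {A : Type v} [Field k] [AddCommGroup A] [Module k A] [Coalgebra k A]

variable (k A) in
/-- The `i`-th multiplication of a 2-bialgebra as a morphism of coalgebras. -/
def TwoBialgebra.mulCoalgHom [TwoBialgebra k A] (i : Fin 2) : A ⊗[k] A →ₗc[k] A :=
  letI := ring k A i
  letI := TwoBialgebra.bialgebra k A i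
  Bialgebra.mulCoalgHom k A

variable (k A) in
/-- The antipodes of a cocommutative 2-Hopf algebra as morphisms of coalgebras. -/
def TwoHopfAlgebra.antipodeCoalgHom [TwoHopfAlgebra k A] [IsCocomm k A] (i : Fin 2) :
    A →ₗc[k] A :=
  { antipode k i with
    counit_comp := LinearMap.ext fun x => counit_antipode i x
    map_comp_comul := LinearMap.ext fun x => by
      refine Eq.trans ?_ (comul_antipode i x).symm
      -- Cocommutativity absorbs the flip in the formula for the comultiplication of an antipode.
      rw [← TensorProduct.map_comm, comm_comul]
      rfl }

variable (k A) in
/-- The map `x ⊗ z ↦ S(x₍₁₎) · (x₍₂₎ ⋄ z)` of a cocommutative 2-Hopf algebra. -/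
def antipodeActionCoalgHom [TwoHopfAlgebra k A] [IsCocomm k A] : A ⊗[k] A →ₗc[k] A :=
  (TwoBialgebra.mulCoalgHom k A 0).comp
    ((Coalgebra.TensorProduct.map (TwoHopfAlgebra.antipodeCoalgHom k A 0)
      (TwoBialgebra.mulCoalgHom k A 1)).comp
      ((Coalgebra.TensorProduct.assoc k k A A A : _ →ₗc[k] _).comp
        (Coalgebra.TensorProduct.map (comulCoalgHom k A) (CoalgHom.id k A))))

variable (k A) in
/-- The map `x ⊗ (y ⊗ z) ↦ x ⋄ (y · z)`. -/
def braceLHSCoalgHom [TwoBialgebra k A] : A ⊗[k] (A ⊗[k] A) →ₗc[k] A :=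
  (TwoBialgebra.mulCoalgHom k A 1).comp
    (Coalgebra.TensorProduct.map (CoalgHom.id k A) (TwoBialgebra.mulCoalgHom k A 0))

variable (k A) in
/-- The map `x ⊗ (y ⊗ z) ↦ (x₍₁₎ ⋄ y) · S(x₍₂₎) · (x₍₃₎ ⋄ z)` of a cocommutative 2-Hopf algebra. -/
def braceRHSCoalgHom [TwoHopfAlgebra k A] [IsCocomm k A] : A ⊗[k] (A ⊗[k] A) →ₗc[k] A :=
  (TwoBialgebra.mulCoalgHom k A 0).comp
    -- The first copy of `x` is paired with `y` and the second with `z`; the action map then splits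
    -- the second copy once more. Cocommutativity is what makes these copying maps coalgebra maps.
    ((Coalgebra.TensorProduct.map (TwoBialgebra.mulCoalgHom k A 1)
      (antipodeActionCoalgHom k A)).comp
      ((tensorTensorTensorCommCoalgHom k A A A A).comp
        (Coalgebra.TensorProduct.map (comulCoalgHom k A) (CoalgHom.id k (A ⊗[k] A)))))

theorem antipodeActionCoalgHom_tmul [TwoHopfAlgebra k A] [IsCocomm k A] (x z : A) :
    antipodeActionCoalgHom k A (x ⊗ₜ z) =
      lift (mul k 0) (map (antipode k 0) ((mul k 1).flip z) (comul (R := k) x)) := by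
  change lift (mul k 0) (map (antipode k 0) (lift (mul k 1))
    (TensorProduct.assoc k A A A (comul (R := k) x ⊗ₜ z))) = _
  generalize comul (R := k) x = t
  induction t using TensorProduct.induction_on with
  | zero => simp
  | add s s' hs hs' => simp only [map_add, add_tmul, hs, hs']
  | tmul a b => rfl

theorem braceRHSCoalgHom_tmul [TwoHopfAlgebra k A] [IsCocomm k A] (x y z : A) :
    braceRHSCoalgHom k A (x ⊗ₜ (y ⊗ₜ z)) = hopfBraceRHS k x y z := by
  change lift (mul k 0) (map (lift (mul k 1)) (antipodeActionCoalgHom k A).toLinearMap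
    (TensorProduct.tensorTensorTensorComm k A A A A (comul (R := k) x ⊗ₜ (y ⊗ₜ z)))) = _
  unfold hopfBraceRHS
  generalize comul (R := k) x = t
  induction t using TensorProduct.induction_on with
  | zero => simp
  | add s s' hs hs' => simp only [map_add, add_tmul, hs, hs']
  | tmul a b =>
    exact congrArg (mul k 0 (mul k 1 a y)) (antipodeActionCoalgHom_tmul b z)

/-- Both sides of the brace identity are coalgebra maps, also after restriction along `q l ⊗ (q m ⊗
q n)`. The span is the sum over all triples of indices of the ranges of the differences. Allowing a
family `q` treats the full relations and those between elements of the images at once. -/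
theorem isCoideal_span_braceRelations [TwoHopfAlgebra k A] [IsCocomm k A] {I : Type*}
    {C : I → Type*} [∀ l, AddCommGroup (C l)] [∀ l, Module k (C l)] [∀ l, Coalgebra k (C l)]
    (q : ∀ l, C l →ₗc[k] A) {s : Set A} (hs : ∀ x, x ∈ s ↔ ∃ l y, q l y = x) :
    (Submodule.span k {a | ∃ x ∈ s, ∃ y ∈ s, ∃ z ∈ s,
      a = mul k 1 x (mul k 0 y z) - hopfBraceRHS k x y z}).IsCoideal := by
  set J := Submodule.span k {a | ∃ x ∈ s, ∃ y ∈ s, ∃ z ∈ s,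
      a = mul k 1 x (mul k 0 y z) - hopfBraceRHS k x y z}
  let Q : ∀ p : I × I × I, C p.1 ⊗[k] (C p.2.1 ⊗[k] C p.2.2) →ₗc[k] A ⊗[k] (A ⊗[k] A) :=
    fun p => Coalgebra.TensorProduct.map (q _) (Coalgebra.TensorProduct.map (q _) (q _))
  have hQ : ∀ p a b c, (((braceLHSCoalgHom k A).comp (Q p)).toLinearMap -
      ((braceRHSCoalgHom k A).comp (Q p)).toLinearMap) (a ⊗ₜ (b ⊗ₜ c)) =
      mul k 1 (q _ a) (mul k 0 (q _ b) (q _ c)) - hopfBraceRHS k (q _ a) (q _ b) (q _ c) := by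
    intro p a b c
    rw [← braceRHSCoalgHom_tmul]
    rfl
  have : J = ⨆ p, LinearMap.range (((braceLHSCoalgHom k A).comp (Q p)).toLinearMap -
      ((braceRHSCoalgHom k A).comp (Q p)).toLinearMap) := by
    apply le_antisymm
    · refine Submodule.span_le.2 ?_
      rintro _ ⟨x, hx, y, hy, z, hz, rfl⟩
      obtain ⟨l, x, rfl⟩ := (hs x).1 hx
      obtain ⟨m, y, rfl⟩ := (hs y).1 hy
      obtain ⟨n, z, rfl⟩ := (hs z).1 hz
      exact Submodule.mem_iSup_of_mem (l, m, n) ⟨x ⊗ₜ (y ⊗ₜ z), hQ (l, m, n) x y z⟩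
    · refine iSup_le fun p => ?_
      rintro _ ⟨t, rfl⟩
      induction t using TensorProduct.induction_on with
      | zero => rw [map_zero]; exact J.zero_mem
      | add t t' ht ht' => rw [map_add]; exact J.add_mem ht ht'
      | tmul a t =>
        induction t using TensorProduct.induction_on with
        | zero => rw [tmul_zero, map_zero]; exact J.zero_mem
        | add t t' ht ht' => rw [tmul_add, map_add]; exact J.add_mem ht ht'
        | tmul b c =>
          rw [hQ]
          exact Submodule.subset_span ⟨_, (hs _).2 ⟨_, _, rfl⟩, _, (hs _).2 ⟨_, _, rfl⟩, _,
            (hs _).2 ⟨_, _, rfl⟩, rfl⟩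
  rw [this]
  exact isCoideal_iSup fun p => isCoideal_range_sub _ _

end Brace

/-! ### Linear maps of 2-algebras, without coalgebra structures -/

/-- A linear map between 2-algebras that preserves the unit and both multiplications. -/
structure IsTwoAlgHom {k A B : Type*} [Field k] [AddCommGroup A] [Module k A] [TwoAlgebra k A]
    [AddCommGroup B] [Module k B] [TwoAlgebra k B] (f : A →ₗ[k] B) : Prop where
  map_one : f (one k) = one k
  map_mul : ∀ i x y, f (mul k i x y) = mul k i (f x) (f y)

namespace IsTwoAlgHom

variable {k A B C D : Type*} [Field k] [AddCommGroup A] [Module k A] [TwoAlgebra k A]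
  [AddCommGroup B] [Module k B] [TwoAlgebra k B] [AddCommGroup C] [Module k C] [TwoAlgebra k C]
  [AddCommGroup D] [Module k D] [TwoAlgebra k D]

theorem comp {g : B →ₗ[k] C} {f : A →ₗ[k] B} (hg : IsTwoAlgHom g) (hf : IsTwoAlgHom f) :
    IsTwoAlgHom (g ∘ₗ f) where
  map_one := by simp [hf.map_one, hg.map_one]
  map_mul := by simp [hf.map_mul, hg.map_mul]

theorem tensorMap {f : A →ₗ[k] C} {g : B →ₗ[k] D} (hf : IsTwoAlgHom f) (hg : IsTwoAlgHom g) :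
    IsTwoAlgHom (TensorProduct.map f g) where
  map_one := congr($hf.map_one ⊗ₜ[k] $hg.map_one)
  map_mul i := FreeTwoAlgebra.map_mul_of_mul f g i (hf.map_mul i) (hg.map_mul i)

variable (k A B) in
theorem tensorComm : IsTwoAlgHom (TensorProduct.comm k A B).toLinearMap where
  map_one := rfl
  map_mul i s t := by
    induction s using TensorProduct.induction_on with
    | zero => simp
    | add s s' hs hs' => simp only [_root_.map_add, LinearMap.add_apply, hs, hs']
    | tmul a b =>
      induction t using TensorProduct.induction_on with
      | zero => simp
      | add t t' ht ht' => simp only [_root_.map_add, ht, ht']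
      | tmul c d => rfl

theorem apply_lift_map {f : A →ₗ[k] B} (hf : IsTwoAlgHom f) {V W : Type*} [AddCommGroup V]
    [Module k V] [AddCommGroup W] [Module k W] (i : Fin 2) (p : V →ₗ[k] A) (q : W →ₗ[k] A)
    (t : V ⊗[k] W) :
    f (lift (mul k i) (map p q t)) = lift (mul k i) (map (f ∘ₗ p) (f ∘ₗ q) t) := by
  induction t using TensorProduct.induction_on with
  | zero => simp
  | add s s' hs hs' => simp only [_root_.map_add, hs, hs']
  | tmul a b => exact hf.map_mul i _ _

end IsTwoAlgHom

theorem isTwoAlgHom_comul (k : Type u) {A : Type v} [Field k] [AddCommGroup A] [Module k A]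
    [Coalgebra k A] [TwoBialgebra k A] : IsTwoAlgHom (comul (R := k) (A := A)) :=
  ⟨TwoBialgebra.comul_one, TwoBialgebra.comul_mul⟩

theorem isTwoAlgHom_counit (k : Type u) {A : Type v} [Field k] [AddCommGroup A] [Module k A]
    [Coalgebra k A] [TwoBialgebra k A] : IsTwoAlgHom (counit (R := k) (A := A)) :=
  ⟨TwoBialgebra.counit_one, TwoBialgebra.counit_mul⟩

/-! ### The free 2-algebra with two operators on a 2-algebra -/

namespace FreeOperatorAlgebra

/-- Formal expressions in the elements of `B`, the operations of a 2-algebra and two unary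
operations. -/
inductive Pre (k : Type u) (B : Type u) : Type u
  | of (x : B)
  | add (a b : Pre k B)
  | smul (c : k) (a : Pre k B)
  | mul (i : Fin 2) (a b : Pre k B)
  | op (i : Fin 2) (a : Pre k B)

variable (k : Type u) (B : Type u) [Field k] [AddCommGroup B] [Module k B] [TwoAlgebra k B]

section
variable {k B} {A : Type u} [AddCommGroup A] [Module k A] [TwoAlgebra k A]

/-- Evaluation of formal expressions in a 2-algebra with two operators. -/
def eval (σ : Fin 2 → A →ₗ[k] A) (f : B →ₗ[k] A) : Pre k B → A
  | .of x => f x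
  | .add a b => eval σ f a + eval σ f b
  | .smul c a => c • eval σ f a
  | .mul i a b => mul k i (eval σ f a) (eval σ f b)
  | .op i a => σ i (eval σ f a)

end

/-- Two formal expressions are identified if they agree in all 2-algebras with two operators
and a morphism of 2-algebras from `B`. -/
def Rel (a b : Pre k B) : Prop :=
  ∀ (A : Type u) [AddCommGroup A] [Module k A] [TwoAlgebra k A] (σ : Fin 2 → A →ₗ[k] A)
    (f : B →ₗ[k] A), IsTwoAlgHom f → eval σ f a = eval σ f b

end FreeOperatorAlgebra

/-- The free 2-algebra with two linear operators on a 2-algebra `B`. -/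
def FreeOperatorAlgebra (k : Type u) (B : Type u) [Field k] [AddCommGroup B] [Module k B]
    [TwoAlgebra k B] : Type u :=
  Quot (FreeOperatorAlgebra.Rel k B)

namespace FreeOperatorAlgebra

section
variable {k : Type u} {B : Type u} [Field k] [AddCommGroup B] [Module k B] [TwoAlgebra k B]

instance : Zero (FreeOperatorAlgebra k B) := ⟨Quot.mk _ (.of 0)⟩

/-- The relation is agreement under every evaluation. Hence each operation descends to the quotient,
and each axiom holds there because it holds in every test algebra; no list of generating relations
is needed. -/
instance : Add (FreeOperatorAlgebra k B) :=
  ⟨Quot.map₂ .add (fun _ _ _ h A _ _ _ σ f hf => congrArg (_ + ·) (h A σ f hf))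
    (fun _ _ _ h A _ _ _ σ f hf => congrArg (· + _) (h A σ f hf))⟩

instance : SMul k (FreeOperatorAlgebra k B) :=
  ⟨fun c => Quot.map (.smul c) (fun _ _ h A _ _ _ σ f hf => congrArg (c • ·) (h A σ f hf))⟩

instance : Neg (FreeOperatorAlgebra k B) := ⟨fun a => (-1 : k) • a⟩

theorem zero_add_aux (a : FreeOperatorAlgebra k B) : 0 + a = a := by
  rcases a with ⟨a⟩
  refine Quot.sound fun A _ _ _ σ f _ => ?_
  simp [eval]

theorem add_comm_aux (a b : FreeOperatorAlgebra k B) : a + b = b + a := by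
  rcases a with ⟨a⟩; rcases b with ⟨b⟩
  exact Quot.sound fun A _ _ _ σ f _ => add_comm _ _

instance : AddCommGroup (FreeOperatorAlgebra k B) where
  add_assoc := by rintro ⟨a⟩ ⟨b⟩ ⟨c⟩; exact Quot.sound fun A _ _ _ σ f _ => add_assoc _ _ _
  zero_add := zero_add_aux
  add_zero a := (add_comm_aux a 0).trans (zero_add_aux a)
  add_comm := add_comm_aux
  neg_add_cancel := by
    rintro ⟨a⟩
    refine Quot.sound fun A _ _ _ σ f _ => ?_
    simp [eval]
  nsmul := nsmulRec
  zsmul := zsmulRec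

instance : Module k (FreeOperatorAlgebra k B) :=
  Module.ofMinimalAxioms
    (by rintro c ⟨a⟩ ⟨b⟩; exact Quot.sound fun A _ _ _ σ f _ => smul_add _ _ _)
    (by rintro c d ⟨a⟩; exact Quot.sound fun A _ _ _ σ f _ => add_smul _ _ _)
    (by rintro c d ⟨a⟩; exact Quot.sound fun A _ _ _ σ f _ => mul_smul _ _ _)
    (by rintro ⟨a⟩; exact Quot.sound fun A _ _ _ σ f _ => one_smul _ _)

instance : TwoAlgebra k (FreeOperatorAlgebra k B) where
  -- The unit is that of `B`, and expressions have no separate unit: the test maps are required to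
  -- preserve it.
  one := Quot.mk _ (.of (one k))
  mul i := LinearMap.mk₂ k
    (Quot.map₂ (.mul i)
      (fun a _ _ h A _ _ _ σ f hf => congrArg (mul k i (eval σ f a)) (h A σ f hf))
      (fun _ _ b h A _ _ _ σ f hf => congrArg (fun x => mul k i x (eval σ f b)) (h A σ f hf)))
    (by rintro ⟨a⟩ ⟨b⟩ ⟨c⟩; exact Quot.sound fun A _ _ _ σ f _ => LinearMap.map_add₂ _ _ _ _)
    (by rintro c ⟨a⟩ ⟨b⟩; exact Quot.sound fun A _ _ _ σ f _ => LinearMap.map_smul₂ _ _ _ _)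
    (by rintro ⟨a⟩ ⟨b⟩ ⟨c⟩; exact Quot.sound fun A _ _ _ σ f _ => map_add _ _ _)
    (by rintro c ⟨a⟩ ⟨b⟩; exact Quot.sound fun A _ _ _ σ f _ => map_smul _ _ _)
  one_mul := by
    rintro i ⟨a⟩
    exact Quot.sound fun A _ _ _ σ f hf =>
      (congrArg (fun x => mul k i x (eval σ f a)) hf.map_one).trans (TwoAlgebra.one_mul i _)
  mul_one := by
    rintro i ⟨a⟩
    exact Quot.sound fun A _ _ _ σ f hf =>
      (congrArg (mul k i (eval σ f a)) hf.map_one).trans (TwoAlgebra.mul_one i _)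
  mul_assoc := by
    rintro i ⟨a⟩ ⟨b⟩ ⟨c⟩
    exact Quot.sound fun A _ _ _ σ f _ => TwoAlgebra.mul_assoc _ _ _ _

variable (k B) in
/-- The canonical map from `B`. -/
def ι : B →ₗ[k] FreeOperatorAlgebra k B where
  toFun x := Quot.mk _ (.of x)
  map_add' x y := Quot.sound fun _ _ _ _ _ f _ => map_add f x y
  map_smul' c x := Quot.sound fun _ _ _ _ _ f _ => map_smul f c x

theorem isTwoAlgHom_ι : IsTwoAlgHom (ι k B) where
  map_one := rfl
  map_mul i x y := Quot.sound fun _ _ _ _ _ _ hf => hf.map_mul i x y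

variable (k B) in
/-- The two operators. -/
def op (i : Fin 2) : FreeOperatorAlgebra k B →ₗ[k] FreeOperatorAlgebra k B where
  toFun := Quot.map (.op i) (fun _ _ h A _ _ _ σ f hf => congrArg (σ i) (h A σ f hf))
  map_add' := by rintro ⟨a⟩ ⟨b⟩; exact Quot.sound fun A _ _ _ σ f _ => map_add _ _ _
  map_smul' := by rintro c ⟨a⟩; exact Quot.sound fun A _ _ _ σ f _ => map_smul _ _ _

@[elab_as_elim]
theorem induction {P : FreeOperatorAlgebra k B → Prop} (of : ∀ x, P (ι k B x))
    (add : ∀ a b, P a → P b → P (a + b)) (smul : ∀ (c : k) a, P a → P (c • a))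
    (mul : ∀ i a b, P a → P b → P (mul k i a b)) (op : ∀ i a, P a → P (op k B i a))
    (a : FreeOperatorAlgebra k B) : P a := by
  rcases a with ⟨a⟩
  induction a with
  | of x => exact of x
  | add a b ha hb => exact add _ _ ha hb
  | smul c a ha => exact smul c _ ha
  | mul i a b ha hb => exact mul i _ _ ha hb
  | op i a ha => exact op i _ ha

variable {A : Type u} [AddCommGroup A] [Module k A] [TwoAlgebra k A]

/-- The morphism extending a morphism of 2-algebras from `B`. -/
def lift (σ : Fin 2 → A →ₗ[k] A) {f : B →ₗ[k] A} (hf : IsTwoAlgHom f) :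
    FreeOperatorAlgebra k B →ₗ[k] A where
  toFun := Quot.lift (eval σ f) (fun _ _ h => h A σ f hf)
  map_add' := by rintro ⟨a⟩ ⟨b⟩; rfl
  map_smul' := by rintro c ⟨a⟩; rfl

theorem isTwoAlgHom_lift (σ : Fin 2 → A →ₗ[k] A) {f : B →ₗ[k] A} (hf : IsTwoAlgHom f) :
    IsTwoAlgHom (lift σ hf) where
  map_one := hf.map_one
  map_mul := by rintro i ⟨a⟩ ⟨b⟩; rfl

@[simp] theorem lift_ι (σ : Fin 2 → A →ₗ[k] A) {f : B →ₗ[k] A} (hf : IsTwoAlgHom f) (x : B) :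
    lift σ hf (ι k B x) = f x := rfl

@[simp] theorem lift_op (σ : Fin 2 → A →ₗ[k] A) {f : B →ₗ[k] A} (hf : IsTwoAlgHom f) (i : Fin 2)
    (x : FreeOperatorAlgebra k B) : lift σ hf (op k B i x) = σ i (lift σ hf x) := by
  rcases x with ⟨a⟩; rfl

end

section Coalgebra
variable {k : Type u} {B : Type u} [Field k] [AddCommGroup B] [Module k B] [Coalgebra k B]
  [TwoBialgebra k B]

/-- The operators chosen on the targets are those which antipodes obey: flip and apply the operator
to both factors for the comultiplication, do nothing for the counit. The operators are thereby
anticomultiplicative by construction. -/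
instance : CoalgebraStruct k (FreeOperatorAlgebra k B) where
  comul := lift (fun i => (TensorProduct.comm k _ _).toLinearMap ∘ₗ
    TensorProduct.map (op k B i) (op k B i))
    ((isTwoAlgHom_ι.tensorMap isTwoAlgHom_ι).comp (isTwoAlgHom_comul k))
  counit := lift (fun _ => LinearMap.id) (isTwoAlgHom_counit k)

theorem comul_ι (x : B) : comul (R := k) (ι k B x) =
    TensorProduct.map (ι k B) (ι k B) (comul (R := k) x) := rfl

theorem comul_op (i : Fin 2) (x : FreeOperatorAlgebra k B) : comul (R := k) (op k B i x) =
    TensorProduct.comm k _ _ (TensorProduct.map (op k B i) (op k B i) (comul (R := k) x)) :=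
  lift_op _ _ i x

theorem counit_op (i : Fin 2) (x : FreeOperatorAlgebra k B) :
    counit (R := k) (op k B i x) = counit (R := k) x :=
  lift_op _ _ i x

theorem isTwoAlgHom_comul' : IsTwoAlgHom (comul (R := k) (A := FreeOperatorAlgebra k B)) :=
  isTwoAlgHom_lift _ _

theorem isTwoAlgHom_counit' : IsTwoAlgHom (counit (R := k) (A := FreeOperatorAlgebra k B)) :=
  isTwoAlgHom_lift _ _

/-- The two counit laws are proved together because the operators flip the comultiplication: either
law at `op i a` follows from the other law at `a`. -/
theorem counit_comul_aux (a : FreeOperatorAlgebra k B) :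
    LinearMap.rTensor _ counit (comul (R := k) a) = 1 ⊗ₜ[k] a ∧
      LinearMap.lTensor _ counit (comul (R := k) a) = a ⊗ₜ[k] 1 := by
  rw [LinearMap.rTensor_def, LinearMap.lTensor_def]
  induction a using induction with
  | of x =>
    have h1 := congrArg (TensorProduct.map LinearMap.id (ι k B))
      (Coalgebra.rTensor_counit_comul (R := k) x)
    have h2 := congrArg (TensorProduct.map (ι k B) LinearMap.id)
      (Coalgebra.lTensor_counit_comul (R := k) x)
    rw [LinearMap.rTensor_def, TensorProduct.map_map] at h1
    rw [LinearMap.lTensor_def, TensorProduct.map_map] at h2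
    rw [comul_ι, TensorProduct.map_map, TensorProduct.map_map]
    exact ⟨h1, h2⟩
  | add a b ha hb =>
    simp only [map_add, ha.1, ha.2, hb.1, hb.2, tmul_add, TensorProduct.add_tmul, and_self]
  | smul c a ha =>
    simp only [map_smul, ha.1, ha.2, TensorProduct.smul_tmul', tmul_smul, and_self]
  | mul i a b ha hb =>
    rw [isTwoAlgHom_comul'.map_mul,
      FreeTwoAlgebra.map_mul_of_mul _ _ i (isTwoAlgHom_counit'.map_mul i) (fun _ _ => rfl),
      FreeTwoAlgebra.map_mul_of_mul _ _ i (fun _ _ => rfl) (isTwoAlgHom_counit'.map_mul i),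
      ha.1, ha.2, hb.1, hb.2]
    constructor
    · change (1 * 1 : k) ⊗ₜ[k] mul k i a b = 1 ⊗ₜ[k] mul k i a b
      rw [_root_.mul_one]
    · change mul k i a b ⊗ₜ[k] (1 * 1 : k) = mul k i a b ⊗ₜ[k] (1 : k)
      rw [_root_.mul_one]
  | op i a ha =>
    have hc : (counit : FreeOperatorAlgebra k B →ₗ[k] k) ∘ₗ op k B i = counit :=
      LinearMap.ext fun x => counit_op i x
    have h1 := congrArg (TensorProduct.map LinearMap.id (op k B i)) ha.1
    have h2 := congrArg (TensorProduct.map (op k B i) LinearMap.id) ha.2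
    rw [TensorProduct.map_map, LinearMap.id_comp, LinearMap.comp_id] at h1 h2
    rw [comul_op, TensorProduct.map_comm, TensorProduct.map_comm, TensorProduct.map_map,
      TensorProduct.map_map, hc, LinearMap.id_comp, h1, h2]
    exact ⟨rfl, rfl⟩

instance : Coalgebra k (FreeOperatorAlgebra k B) where
  coassoc := by
    ext a
    induction a using induction with
    | of x =>
      have h := congrArg (TensorProduct.map (ι k B) (TensorProduct.map (ι k B) (ι k B)))
        (Coalgebra.coassoc_apply (R := k) x)
      simp only [LinearMap.comp_apply, LinearEquiv.coe_coe, comul_ι]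
      generalize comul (R := k) x = s at h ⊢
      have h1 : ∀ s : B ⊗[k] B, (TensorProduct.assoc k _ _ _)
          (LinearMap.rTensor (FreeOperatorAlgebra k B) comul
            (TensorProduct.map (ι k B) (ι k B) s)) =
          TensorProduct.map (ι k B) (TensorProduct.map (ι k B) (ι k B))
            (TensorProduct.assoc k B B B (LinearMap.rTensor B comul s)) := by
        intro s
        rw [TensorProduct.map_map_assoc, LinearMap.rTensor_map, LinearMap.rTensor_def,
          TensorProduct.map_map]
        rfl
      have h2 : ∀ s : B ⊗[k] B, LinearMap.lTensor (FreeOperatorAlgebra k B) comul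
            (TensorProduct.map (ι k B) (ι k B) s) =
          TensorProduct.map (ι k B) (TensorProduct.map (ι k B) (ι k B))
            (LinearMap.lTensor B comul s) := by
        intro s
        rw [LinearMap.lTensor_map, LinearMap.lTensor_def, TensorProduct.map_map]
        rfl
      rw [h1, h2]
      exact h
    | add a b ha hb => rw [map_add, ha, hb, map_add]
    | smul c a ha => rw [map_smul, ha, map_smul]
    | mul i a b ha hb =>
      simp only [LinearMap.comp_apply, LinearEquiv.coe_coe] at ha hb ⊢
      rw [isTwoAlgHom_comul'.map_mul,
        LinearMap.rTensor_def, LinearMap.lTensor_def,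
        FreeTwoAlgebra.map_mul_of_mul _ _ i (isTwoAlgHom_comul'.map_mul i) (fun _ _ => rfl),
        FreeTwoAlgebra.map_mul_of_mul _ _ i (fun _ _ => rfl) (isTwoAlgHom_comul'.map_mul i),
        FreeTwoAlgebra.assoc_mul]
      rw [LinearMap.rTensor_def, LinearMap.lTensor_def] at ha hb
      rw [ha, hb]
    | op i a ha =>
      simp only [LinearMap.comp_apply, LinearEquiv.coe_coe, comul_op] at ha ⊢
      let S := op k B i
      -- `W` sends `x ⊗ (y ⊗ z)` to `(S z ⊗ S y) ⊗ S x`. It carries each side of coassociativity at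
      -- `a` to the opposite side at `S a`.
      let W := (TensorProduct.comm k _ _).toLinearMap ∘ₗ TensorProduct.map S
        ((TensorProduct.comm k _ _).toLinearMap ∘ₗ TensorProduct.map S S)
      have h1 : ∀ s, (TensorProduct.assoc k _ _ _) (LinearMap.rTensor _ comul
          (TensorProduct.comm k _ _ (TensorProduct.map S S s))) =
          TensorProduct.assoc k _ _ _ (W (LinearMap.lTensor _ comul s)) := by
        intro s
        induction s using TensorProduct.induction_on with
        | zero => simp
        | add s t hs ht => simp only [map_add, hs, ht]
        | tmul a b => simp [S, W, comul_op]
      have h2 : ∀ s, (LinearMap.lTensor _ comul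
          (TensorProduct.comm k _ _ (TensorProduct.map S S s))) =
          TensorProduct.assoc k _ _ _ (W (TensorProduct.assoc k _ _ _
            (LinearMap.rTensor _ comul s))) := by
        intro s
        induction s using TensorProduct.induction_on with
        | zero => simp
        | add s t hs ht => simp only [map_add, hs, ht]
        | tmul a b =>
          simp only [S, W, TensorProduct.map_tmul, TensorProduct.comm_tmul, LinearMap.lTensor_tmul,
            LinearMap.rTensor_tmul, comul_op]
          generalize comul (R := k) a = t
          induction t using TensorProduct.induction_on with
          | zero => simp
          | add s t hs ht => simp only [map_add, TensorProduct.add_tmul, tmul_add, hs, ht]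
          | tmul c d => rfl
      rw [h1, h2, ha]
  rTensor_counit_comp_comul := LinearMap.ext fun a => (counit_comul_aux a).1
  lTensor_counit_comp_comul := LinearMap.ext fun a => (counit_comul_aux a).2

instance : TwoBialgebra k (FreeOperatorAlgebra k B) where
  counit_one := isTwoAlgHom_counit'.map_one
  counit_mul := isTwoAlgHom_counit'.map_mul
  comul_one := isTwoAlgHom_comul'.map_one
  comul_mul := isTwoAlgHom_comul'.map_mul

end Coalgebra
end FreeOperatorAlgebra

/-- The quotient of a 2-algebra by an ideal for both multiplications. -/
@[reducible]
def quotientTwoAlgebra {k : Type u} {A : Type v} [Field k] [AddCommGroup A] [Module k A]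
    [TwoAlgebra k A] (L : Submodule k A) (hl : ∀ i a, ∀ x ∈ L, mul k i a x ∈ L)
    (hr : ∀ i a, ∀ x ∈ L, mul k i x a ∈ L) : TwoAlgebra k (A ⧸ L) where
  one := L.mkQ (one k)
  mul i := quotientMul L (mul k i) (hl i) (hr i)
  one_mul i x := by
    obtain ⟨x, rfl⟩ := L.mkQ_surjective x
    simp [TwoAlgebra.one_mul]
  mul_one i x := by
    obtain ⟨x, rfl⟩ := L.mkQ_surjective x
    simp [TwoAlgebra.mul_one]
  mul_assoc i x y z := by
    obtain ⟨x, rfl⟩ := L.mkQ_surjective x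
    obtain ⟨y, rfl⟩ := L.mkQ_surjective y
    obtain ⟨z, rfl⟩ := L.mkQ_surjective z
    simp [TwoAlgebra.mul_assoc]

/-! ### The free 2-Hopf algebra as a quotient by the antipode relations -/

namespace FreeOperatorAlgebra

variable {k : Type u} {B : Type u} [Field k] [AddCommGroup B] [Module k B] [Coalgebra k B]
  [TwoBialgebra k B]

variable (k B) in
/-- The elements `σ(x₍₁₎) x₍₂₎ - ε(x) 1` and `x₍₁₎ σ(x₍₂₎) - ε(x) 1` for both multiplications,
where `σ` is the operator that is to become the antipode. -/
def antipodeRelations : Set (FreeOperatorAlgebra k B) :=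
  {a | ∃ i x, a = TensorProduct.lift (mul k i) (map (op k B i) LinearMap.id (comul (R := k) x)) -
      counit (R := k) x • one k} ∪
  {a | ∃ i x, a = TensorProduct.lift (mul k i) (map LinearMap.id (op k B i) (comul (R := k) x)) -
      counit (R := k) x • one k}

/-- A subspace stable under multiplication by arbitrary elements and under the operators. -/
structure IsOperatorIdeal (L : Submodule k (FreeOperatorAlgebra k B)) : Prop where
  mul_left_mem : ∀ i a, ∀ x ∈ L, mul k i a x ∈ L
  mul_right_mem : ∀ i a, ∀ x ∈ L, mul k i x a ∈ L
  op_mem : ∀ i, ∀ x ∈ L, op k B i x ∈ L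

variable (k B) in
/-- The ideal generated by the antipode relations. -/
def antipodeIdeal : Submodule k (FreeOperatorAlgebra k B) :=
  sInf {L | antipodeRelations k B ⊆ L ∧ IsOperatorIdeal L}

theorem antipodeRelations_subset : antipodeRelations k B ⊆ antipodeIdeal k B := fun _ hx =>
  Submodule.mem_sInf.2 fun _ hL => hL.1 hx

theorem antipodeIdeal_le {L : Submodule k (FreeOperatorAlgebra k B)}
    (h : antipodeRelations k B ⊆ L) (hL : IsOperatorIdeal L) : antipodeIdeal k B ≤ L :=
  sInf_le ⟨h, hL⟩

theorem isOperatorIdeal_antipodeIdeal : IsOperatorIdeal (antipodeIdeal k B) where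
  mul_left_mem i a _ hx := Submodule.mem_sInf.2 fun L hL =>
    hL.2.mul_left_mem i a _ (Submodule.mem_sInf.1 hx L hL)
  mul_right_mem i a _ hx := Submodule.mem_sInf.2 fun L hL =>
    hL.2.mul_right_mem i a _ (Submodule.mem_sInf.1 hx L hL)
  op_mem i _ hx := Submodule.mem_sInf.2 fun L hL =>
    hL.2.op_mem i _ (Submodule.mem_sInf.1 hx L hL)

variable (k B) in
/-- The operators on the quotient by the ideal of the antipode relations. -/
def quotientOp (i : Fin 2) : FreeOperatorAlgebra k B ⧸ antipodeIdeal k B →ₗ[k]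
    FreeOperatorAlgebra k B ⧸ antipodeIdeal k B :=
  (antipodeIdeal k B).mapQ _ (op k B i) (isOperatorIdeal_antipodeIdeal.op_mem i)

theorem mkQ_comp_op (i : Fin 2) : (antipodeIdeal k B).mkQ ∘ₗ op k B i =
    quotientOp k B i ∘ₗ (antipodeIdeal k B).mkQ := rfl

/-- The 2-algebra structure on the quotient by the ideal of the antipode relations. -/
@[reducible]
def quotientAntipodeIdealTwoAlgebra : TwoAlgebra k (FreeOperatorAlgebra k B ⧸ antipodeIdeal k B) :=
  quotientTwoAlgebra _ isOperatorIdeal_antipodeIdeal.mul_left_mem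
    isOperatorIdeal_antipodeIdeal.mul_right_mem

attribute [local instance] quotientAntipodeIdealTwoAlgebra

theorem isTwoAlgHom_mkQ : IsTwoAlgHom (antipodeIdeal k B).mkQ := ⟨rfl, fun _ _ _ => rfl⟩

/-- The composite of projection and operator is a left convolution inverse of the projection. The
source is the algebra before division, since the quotient has no coalgebra structure until its ideal
is known to be a coideal. -/
theorem lift_quotientOp_mkQ (i : Fin 2) (x : FreeOperatorAlgebra k B) :
    TensorProduct.lift (mul k i) (map ((antipodeIdeal k B).mkQ ∘ₗ op k B i)
      (antipodeIdeal k B).mkQ (comul (R := k) x)) = counit (R := k) x • one k := by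
  have h := (Submodule.Quotient.mk_eq_zero _).2 (antipodeRelations_subset (Or.inl ⟨i, x, rfl⟩))
  rw [Submodule.Quotient.mk_sub, sub_eq_zero] at h
  refine Eq.trans ?_ h
  exact (isTwoAlgHom_mkQ.apply_lift_map i (op k B i) LinearMap.id _).symm

theorem lift_mkQ_quotientOp (i : Fin 2) (x : FreeOperatorAlgebra k B) :
    TensorProduct.lift (mul k i) (map (antipodeIdeal k B).mkQ
      ((antipodeIdeal k B).mkQ ∘ₗ op k B i) (comul (R := k) x)) = counit (R := k) x • one k := by
  have h := (Submodule.Quotient.mk_eq_zero _).2 (antipodeRelations_subset (Or.inr ⟨i, x, rfl⟩))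
  rw [Submodule.Quotient.mk_sub, sub_eq_zero] at h
  refine Eq.trans ?_ h
  exact (isTwoAlgHom_mkQ.apply_lift_map i LinearMap.id (op k B i) _).symm

/-- With `π` the projection, the ideal must be killed by the counit and by `(π ⊗ π) ∘ Δ`. Both are
maps of 2-algebras for which composition with an operator gives a two-sided convolution inverse, and
this forces them to vanish on the antipode relations. -/
theorem isTwoBiideal_antipodeIdeal : IsTwoBiideal (antipodeIdeal k B) where
  mul_left_mem := isOperatorIdeal_antipodeIdeal.mul_left_mem
  mul_right_mem := isOperatorIdeal_antipodeIdeal.mul_right_mem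
  isCoideal := by
    -- The common criterion: the kernel of `f` is an operator ideal, and the convolution identities
    -- say that it contains the relations.
    have hk {A : Type u} [AddCommGroup A] [Module k A] [TwoAlgebra k A]
        {f : FreeOperatorAlgebra k B →ₗ[k] A} (hf : IsTwoAlgHom f)
        (hop : ∀ i x, f x = 0 → f (op k B i x) = 0)
        (h1 : ∀ i x, TensorProduct.lift (mul k i) (map (f ∘ₗ op k B i) f (comul (R := k) x)) =
          counit (R := k) x • one k)
        (h2 : ∀ i x, TensorProduct.lift (mul k i) (map f (f ∘ₗ op k B i) (comul (R := k) x)) =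
          counit (R := k) x • one k) : antipodeIdeal k B ≤ LinearMap.ker f := by
      refine antipodeIdeal_le ?_ ⟨fun i a x hx => ?_, fun i a x hx => ?_, hop⟩
      · rintro _ (⟨i, x, rfl⟩ | ⟨i, x, rfl⟩)
        · rw [SetLike.mem_coe, LinearMap.mem_ker, map_sub, map_smul, hf.apply_lift_map, hf.map_one,
            LinearMap.comp_id, h1, sub_self]
        · rw [SetLike.mem_coe, LinearMap.mem_ker, map_sub, map_smul, hf.apply_lift_map, hf.map_one,
            LinearMap.comp_id, h2, sub_self]
      · rw [LinearMap.mem_ker] at hx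
        rw [LinearMap.mem_ker, hf.map_mul, hx, map_zero]
      · rw [LinearMap.mem_ker] at hx
        rw [LinearMap.mem_ker, hf.map_mul, hx, map_zero, LinearMap.zero_apply]
    have hc : ∀ i, counit (R := k) ∘ₗ op k B i = counit := fun i => LinearMap.ext (counit_op i)
    -- The counit is idempotent for convolution, being its neutral element, so it is its own
    -- inverse.
    have hcc : ∀ i x, TensorProduct.lift (mul k i) (map counit counit
        (comul (R := k) (A := FreeOperatorAlgebra k B) x)) = counit (R := k) x • (one k : k) := by
      intro i x
      have := congrArg (LinearMap.mul' k k)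
        (congrArg (map LinearMap.id counit) (rTensor_counit_comul (R := k) x))
      rw [LinearMap.rTensor_def, TensorProduct.map_map] at this
      refine this.trans ?_
      exact mul_comm _ _
    -- This brings the candidate inverse into the flipped form for which `conv_comm_map_map_eq` and
    -- `conv_map_comm_map_eq` give the inverse property.
    have hd : ∀ i, (map (antipodeIdeal k B).mkQ (antipodeIdeal k B).mkQ ∘ₗ comul (R := k)) ∘ₗ
        op k B i = (TensorProduct.comm k _ _).toLinearMap ∘ₗ
          map ((antipodeIdeal k B).mkQ ∘ₗ op k B i) ((antipodeIdeal k B).mkQ ∘ₗ op k B i) ∘ₗ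
            comul (R := k) := by
      intro i
      ext x
      simp only [LinearMap.comp_apply, comul_op, LinearEquiv.coe_coe]
      rw [TensorProduct.map_comm, TensorProduct.map_map]
    have h1 : antipodeIdeal k B ≤
        LinearMap.ker (counit (R := k) (A := FreeOperatorAlgebra k B)) := by
      refine hk (isTwoAlgHom_counit k) (fun i x hx => (counit_op i x).trans hx)
        (fun i x => ?_) fun i x => ?_
      · rw [hc, hcc]
      · rw [hc, hcc]
    have h2 : antipodeIdeal k B ≤ LinearMap.ker
        (map (antipodeIdeal k B).mkQ (antipodeIdeal k B).mkQ ∘ₗ comul (R := k)) := by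
      refine hk ((isTwoAlgHom_mkQ.tensorMap isTwoAlgHom_mkQ).comp (isTwoAlgHom_comul k))
        (fun i x hx => ?_) (fun i x => ?_) fun i x => ?_
      · rw [LinearMap.comp_apply] at hx
        rw [← LinearMap.comp_apply, hd, LinearMap.comp_apply, LinearMap.comp_apply, mkQ_comp_op,
          TensorProduct.map_comp, LinearMap.comp_apply, hx, map_zero, map_zero]
      · rw [hd]
        exact conv_comm_map_map_eq i (lift_quotientOp_mkQ i) x
      · rw [hd]
        exact conv_map_comm_map_eq i (lift_mkQ_quotientOp i) x
    exact ⟨fun x hx => h1 hx, fun x hx => h2 hx⟩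

variable (k B) in
/-- The 2-Hopf algebra structure on the quotient by the antipode relations. -/
@[reducible]
def twoHopfAlgebra :
    letI := isTwoBiideal_antipodeIdeal (k := k) (B := B) |>.isCoideal
    TwoHopfAlgebra k (FreeOperatorAlgebra k B ⧸ antipodeIdeal k B) :=
  letI := isTwoBiideal_antipodeIdeal (k := k) (B := B) |>.isCoideal
  { isTwoBiideal_antipodeIdeal.twoBialgebra with
    antipode := quotientOp k B
    antipode_mul_id := fun i x => by
      obtain ⟨x, rfl⟩ := (antipodeIdeal k B).mkQ_surjective x
      rw [Submodule.mkQ_apply, Coalgebra.Quotient.comul_mk, Coalgebra.Quotient.counit_mk,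
        TensorProduct.map_map]
      exact lift_quotientOp_mkQ i x
    id_mul_antipode := fun i x => by
      obtain ⟨x, rfl⟩ := (antipodeIdeal k B).mkQ_surjective x
      rw [Submodule.mkQ_apply, Coalgebra.Quotient.comul_mk, Coalgebra.Quotient.counit_mk,
        TensorProduct.map_map]
      exact lift_mkQ_quotientOp i x }

section Universal

variable {K : Type u} [AddCommGroup K] [Module k K] [Coalgebra k K] [TwoHopfAlgebra k K]

theorem isTwoAlgHom_lin (f : TwoBialgHom k B K) : IsTwoAlgHom f.lin := ⟨f.map_one, f.map_mul⟩

/-- The extension of a morphism of 2-bialgebras from `B` to a 2-Hopf algebra. -/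
def extend (f : TwoBialgHom k B K) : TwoBialgHom k (FreeOperatorAlgebra k B) K :=
  { toLinearMap := lift (antipode k) (isTwoAlgHom_lin f)
    counit_comp := by
      ext a
      induction a using induction with
      | of x => exact f.counit_apply x
      | add a b ha hb => rw [map_add, ha, hb, map_add]
      | smul c a ha => rw [map_smul, ha, map_smul]
      | mul i a b ha hb =>
        rw [LinearMap.comp_apply] at ha hb ⊢
        rw [(isTwoAlgHom_lift _ _).map_mul, TwoBialgebra.counit_mul, ha, hb,
          TwoBialgebra.counit_mul]
      | op i a ha =>
        rw [LinearMap.comp_apply] at ha ⊢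
        rw [lift_op, _root_.counit_antipode, ha, counit_op]
    map_comp_comul := by
      ext a
      induction a using induction with
      | of x =>
        rw [LinearMap.comp_apply, comul_ι, TensorProduct.map_map]
        exact (f.comul_apply x).symm
      | add a b ha hb => rw [map_add, ha, hb, map_add]
      | smul c a ha => rw [map_smul, ha, map_smul]
      | mul i a b ha hb =>
        rw [LinearMap.comp_apply, LinearMap.comp_apply] at ha hb ⊢
        rw [(isTwoAlgHom_comul k).map_mul,
          ((isTwoAlgHom_lift _ _).tensorMap (isTwoAlgHom_lift _ _)).map_mul, ha, hb,
          (isTwoAlgHom_lift _ _).map_mul, (isTwoAlgHom_comul k).map_mul]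
      | op i a ha =>
        rw [LinearMap.comp_apply, LinearMap.comp_apply] at ha ⊢
        -- The extension turns operators into antipodes of `K`, whose anticomultiplicativity matches
        -- the comultiplication prescribed on operators.
        have : lift (antipode k) (isTwoAlgHom_lin f) ∘ₗ op k B i =
          antipode k i ∘ₗ lift (antipode k) (isTwoAlgHom_lin f) :=
            LinearMap.ext fun x => lift_op _ _ _ _
        rw [lift_op, comul_antipode, comul_op, TensorProduct.map_comm, TensorProduct.map_map, this,
          ← ha, TensorProduct.map_map]
    map_one' := f.map_one
    map_mul' := (isTwoAlgHom_lift _ _).map_mul }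

theorem antipodeIdeal_le_ker_extend (f : TwoBialgHom k B K) :
    antipodeIdeal k B ≤ LinearMap.ker (extend f).lin := by
  have hf : IsTwoAlgHom (extend f).lin := isTwoAlgHom_lift _ (isTwoAlgHom_lin f)
  have hS : ∀ i, (extend f).lin ∘ₗ op k B i = antipode k i ∘ₗ (extend f).lin :=
    fun i => LinearMap.ext fun x => lift_op _ (isTwoAlgHom_lin f) _ _
  refine antipodeIdeal_le ?_ ⟨fun i a x hx => ?_, fun i a x hx => ?_, fun i x hx => ?_⟩
  · rintro _ (⟨i, x, rfl⟩ | ⟨i, x, rfl⟩)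
    · have h := TwoHopfAlgebra.antipode_mul_id (k := k) i (extend f x)
      rw [TwoBialgHom.comul_apply, TensorProduct.map_map, TwoBialgHom.counit_apply] at h
      rw [SetLike.mem_coe, LinearMap.mem_ker, map_sub, map_smul, hf.apply_lift_map, hf.map_one,
        hS, LinearMap.comp_id, ← h, LinearMap.id_comp, sub_self]
    · have h := TwoHopfAlgebra.id_mul_antipode (k := k) i (extend f x)
      rw [TwoBialgHom.comul_apply, TensorProduct.map_map, TwoBialgHom.counit_apply] at h
      rw [SetLike.mem_coe, LinearMap.mem_ker, map_sub, map_smul, hf.apply_lift_map, hf.map_one,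
        hS, LinearMap.comp_id, ← h, LinearMap.id_comp, sub_self]
  · rw [LinearMap.mem_ker] at hx
    rw [LinearMap.mem_ker, hf.map_mul, hx, map_zero]
  · rw [LinearMap.mem_ker] at hx
    rw [LinearMap.mem_ker, hf.map_mul, hx, map_zero, LinearMap.zero_apply]
  · rw [LinearMap.mem_ker] at hx
    rw [LinearMap.mem_ker, ← LinearMap.comp_apply, hS, LinearMap.comp_apply, hx, map_zero]

end Universal

instance [IsCocomm k B] : IsCocomm k (FreeOperatorAlgebra k B) where
  comm_comp_comul := by
    ext a
    simp only [LinearMap.comp_apply, LinearEquiv.coe_coe]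
    induction a using induction with
    | of x => rw [comul_ι, ← TensorProduct.map_comm, comm_comul]
    | add a b ha hb => rw [map_add, map_add, ha, hb]
    | smul c a ha => rw [map_smul, map_smul, ha]
    | mul i a b ha hb =>
      rw [(isTwoAlgHom_comul k).map_mul]
      exact ((IsTwoAlgHom.tensorComm k _ _).map_mul i _ _).trans
        (congrArg₂ (fun s t => mul k i s t) ha hb)
    | op i a ha => rw [comul_op, ← TensorProduct.map_comm, ha, ← TensorProduct.map_comm, ha]

end FreeOperatorAlgebra

/-! ### Left adjoints to the forgetful functors -/

section Adjoint
variable {k : Type u} [Field k]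

open FreeOperatorAlgebra

namespace TwoBialg

/-- The free 2-algebra with two operators on a 2-bialgebra, as a 2-bialgebra. -/
def freeOperatorAlgebra (B : TwoBialg k) : TwoBialg k where
  carrier := FreeOperatorAlgebra k B.carrier

/-- The extension of a morphism to a 2-Hopf algebra. -/
def extend {B : TwoBialg k} {K : TwoHalg k} (f : B ⟶ (TwoHalg.forget k).obj K) :
    freeOperatorAlgebra B ⟶ K.toTwoBialg :=
  show TwoBialgHom k (FreeOperatorAlgebra k B.carrier) K.carrier from
    FreeOperatorAlgebra.extend (show TwoBialgHom k B.carrier K.carrier from f)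

/-- The free 2-Hopf algebra on a 2-bialgebra. -/
def freeHopf (B : TwoBialg k) : TwoHalg k :=
  letI := isTwoBiideal_antipodeIdeal (k := k) (B := B.carrier) |>.isCoideal
  letI := FreeOperatorAlgebra.twoHopfAlgebra k B.carrier
  { carrier := FreeOperatorAlgebra k B.carrier ⧸ antipodeIdeal k B.carrier }

/-- The canonical morphism to the free 2-Hopf algebra. -/
def toFreeHopf (B : TwoBialg k) : B ⟶ (TwoHalg.forget k).obj (freeHopf B) :=
  letI := isTwoBiideal_antipodeIdeal (k := k) (B := B.carrier) |>.isCoideal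
  letI := FreeOperatorAlgebra.twoHopfAlgebra k B.carrier
  show TwoBialgHom k B.carrier (FreeOperatorAlgebra k B.carrier ⧸ antipodeIdeal k B.carrier) from
  { toLinearMap := (antipodeIdeal k B.carrier).mkQ ∘ₗ ι k B.carrier
    counit_comp := rfl
    map_comp_comul := by
      rw [TensorProduct.map_comp]
      rfl
    map_one' := rfl
    map_mul' := fun i x y => congrArg (antipodeIdeal k B.carrier).mkQ
      (isTwoAlgHom_ι.map_mul i x y) }

/-- The morphism from the free 2-Hopf algebra induced by a morphism to a 2-Hopf algebra. -/
def freeHopfDesc {B : TwoBialg k} {K : TwoHalg k} (f : B ⟶ (TwoHalg.forget k).obj K) :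
    freeHopf B ⟶ K :=
  InducedCategory.homMk (F := TwoHalg.toTwoBialg)
    (desc _ isTwoBiideal_antipodeIdeal (extend f)
      (antipodeIdeal_le_ker_extend (show TwoBialgHom k B.carrier K.carrier from f)))

theorem toFreeHopf_freeHopfDesc {B : TwoBialg k} {K : TwoHalg k}
    (f : B ⟶ (TwoHalg.forget k).obj K) :
    toFreeHopf B ≫ (TwoHalg.forget k).map (freeHopfDesc f) = f := rfl

/-- The free 2-Hopf algebra is generated by `B` under the linear operations, the products and the
antipodes, and morphisms commute with antipodes automatically. -/
theorem freeHopf_hom_ext {B : TwoBialg k} {K : TwoHalg k} {f g : freeHopf B ⟶ K}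
    (h : toFreeHopf B ≫ (TwoHalg.forget k).map f = toFreeHopf B ≫ (TwoHalg.forget k).map g) :
    f = g := by
  refine InducedCategory.hom_ext (TwoBialgHom.ext fun x => ?_)
  obtain ⟨x, rfl⟩ := (antipodeIdeal k B.carrier).mkQ_surjective x
  change TwoHalg.bialgHom f _ = TwoHalg.bialgHom g _
  induction x using FreeOperatorAlgebra.induction with
  | of x => exact congr($h x)
  | add a b ha hb =>
    exact ((TwoHalg.bialgHom f).lin.map_add _ _).trans ((congrArg₂ _ ha hb).trans
      ((TwoHalg.bialgHom g).lin.map_add _ _).symm)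
  | smul c a ha =>
    exact ((TwoHalg.bialgHom f).lin.map_smul _ _).trans ((congrArg _ ha).trans
      ((TwoHalg.bialgHom g).lin.map_smul _ _).symm)
  | mul i a b ha hb =>
    exact ((TwoHalg.bialgHom f).map_mul i _ _).trans
      ((congrArg₂ (fun x y => mul k i x y) ha hb).trans ((TwoHalg.bialgHom g).map_mul i _ _).symm)
  | op i a ha =>
    exact ((TwoHalg.bialgHom f).map_antipode i _).trans ((congrArg _ ha).trans
      ((TwoHalg.bialgHom g).map_antipode i _).symm)

theorem isCocomm_freeHopf {B : TwoBialg k} (hB : isCocomm k B) :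
    TwoHalg.isCocomm k (freeHopf B) :=
  have : IsCocomm k B.carrier := hB
  isCocomm_quotient (B := freeOperatorAlgebra B) _ isTwoBiideal_antipodeIdeal
    (inferInstanceAs (IsCocomm k (FreeOperatorAlgebra k B.carrier)))

end TwoBialg

theorem isRightAdjoint_forget : (TwoHalg.forget k).IsRightAdjoint := by
  have (B : TwoBialg k) : HasInitial (StructuredArrow B (TwoHalg.forget k)) :=
    (IsInitial.ofUniqueHom (X := StructuredArrow.mk (TwoBialg.toFreeHopf B))
      (fun Y => StructuredArrow.homMk (TwoBialg.freeHopfDesc Y.hom)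
        (TwoBialg.toFreeHopf_freeHopfDesc _))
      fun Y m => StructuredArrow.ext _ _ (TwoBialg.freeHopf_hom_ext
        ((StructuredArrow.w m).trans (TwoBialg.toFreeHopf_freeHopfDesc Y.hom).symm))).hasInitial
  exact isRightAdjointOfStructuredArrowInitials _

/-- The free 2-Hopf algebra on a cocommutative 2-bialgebra is itself cocommutative, so the same
universal arrow serves in the full subcategories. -/
theorem isRightAdjoint_forget_coc : (TwoHalgCoc.forget k).IsRightAdjoint := by
  have (B : TwoBialgCoc k) : HasInitial (StructuredArrow B (TwoHalgCoc.forget k)) :=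
    (IsInitial.ofUniqueHom (X := StructuredArrow.mk
        (Y := (⟨TwoBialg.freeHopf B.obj, TwoBialg.isCocomm_freeHopf B.property⟩ : TwoHalgCoc k))
        (ObjectProperty.homMk (TwoBialg.toFreeHopf B.obj)))
      (fun Y => StructuredArrow.homMk (ObjectProperty.homMk (TwoBialg.freeHopfDesc Y.hom.hom))
        (ObjectProperty.hom_ext _ (TwoBialg.toFreeHopf_freeHopfDesc _)))
      fun Y m => StructuredArrow.ext _ _ (ObjectProperty.hom_ext _ (TwoBialg.freeHopf_hom_ext
        (congr(($(StructuredArrow.w m)).hom).trans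
          (TwoBialg.toFreeHopf_freeHopfDesc Y.hom.hom).symm)))).hasInitial
  exact isRightAdjointOfStructuredArrowInitials _

end Adjoint

/-! ### Coproducts of 2-bialgebras -/

section CoproductOfBialgebras

/-- A local form of `isCoideal_range_sub`: each generator may come from its own pair of coalgebra
maps on its own source, provided the whole range of their difference stays in the span. This suits
relations of several kinds. -/
theorem isCoideal_span_of_coalgHom {k : Type u} {A : Type v} [Field k] [AddCommGroup A] [Module k A]
    [Coalgebra k A] {s : Set A} (h : ∀ a ∈ s, ∃ (C : Type w) (_ : AddCommGroup C) (_ : Module k C)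
      (_ : Coalgebra k C) (f g : C →ₗc[k] A) (c : C), a = f c - g c ∧
        ∀ c, f c - g c ∈ Submodule.span k s) : (Submodule.span k s).IsCoideal := by
  set J := Submodule.span k s
  have h1 : J ≤ LinearMap.ker (counit (R := k) (A := A)) := by
    refine Submodule.span_le.2 fun a ha => ?_
    obtain ⟨C, _, _, _, f, g, c, rfl, hJ⟩ := h a ha
    exact (isCoideal_range_sub f g).counit_eq_zero ⟨c, rfl⟩
  have h2 : J ≤ LinearMap.ker (map J.mkQ J.mkQ ∘ₗ comul (R := k)) := by
    refine Submodule.span_le.2 fun a ha => ?_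
    obtain ⟨C, _, _, _, f, g, c, rfl, hJ⟩ := h a ha
    refine (isCoideal_range_sub f g).map_mkQ_comul_of_le ?_ ⟨c, rfl⟩
    rintro _ ⟨c, rfl⟩
    exact hJ c
  exact ⟨fun x hx => h1 hx, fun x hx => h2 hx⟩

variable {k : Type u} [Field k]

/-- The unit of a 2-bialgebra as a morphism of coalgebras. -/
def TwoBialgebra.unitCoalgHom (k : Type u) (A : Type v) [Field k] [AddCommGroup A] [Module k A]
    [Coalgebra k A] [TwoBialgebra k A] : k →ₗc[k] A :=
  { LinearMap.toSpanSingleton k A (one k) with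
    counit_comp := by
      ext
      simp [TwoBialgebra.counit_one]
    map_comp_comul := by
      ext
      simp [TwoBialgebra.comul_one] }

namespace FreeTwoAlgebra

theorem isTwoAlgHom_lift {V : Type u} [AddCommGroup V] [Module k V] {A : Type u} [AddCommGroup A]
    [Module k A] [TwoAlgebra k A] (f : V →ₗ[k] A) : IsTwoAlgHom (lift f) :=
  ⟨lift_one f, lift_mul f⟩

variable {V : Type u} [AddCommGroup V] [Module k V] [Coalgebra k V]
  {A : Type u} [AddCommGroup A] [Module k A] [Coalgebra k A] [TwoBialgebra k A]

/-- The canonical map `V → F(V)` as a morphism of coalgebras. -/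
def ιCoalgHom (k : Type u) (V : Type u) [Field k] [AddCommGroup V] [Module k V] [Coalgebra k V] :
    V →ₗc[k] FreeTwoAlgebra k V :=
  { ι k with
    counit_comp := rfl
    map_comp_comul := rfl }

/-- The morphism of 2-bialgebras extending a morphism of coalgebras from `V`. -/
def liftHom (f : V →ₗc[k] A) : TwoBialgHom k (FreeTwoAlgebra k V) A :=
  { toLinearMap := lift f.toLinearMap
    counit_comp := by
      ext a
      induction a using induction with
      | of x => exact congr($f.counit_comp x)
      | one => exact TwoBialgebra.counit_one
      | add a b ha hb => rw [map_add, ha, hb, map_add]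
      | smul c a ha => rw [map_smul, ha, map_smul]
      | mul i a b ha hb =>
        rw [LinearMap.comp_apply] at ha hb ⊢
        rw [lift_mul, TwoBialgebra.counit_mul, ha, hb, TwoBialgebra.counit_mul]
    map_comp_comul := by
      ext a
      induction a using induction with
      | of x =>
        rw [LinearMap.comp_apply, comul_ι, TensorProduct.map_map]
        exact congr($f.map_comp_comul x)
      | one => exact TwoBialgebra.comul_one.symm
      | add a b ha hb => rw [map_add, ha, hb, map_add]
      | smul c a ha => rw [map_smul, ha, map_smul]
      | mul i a b ha hb =>
        rw [LinearMap.comp_apply, LinearMap.comp_apply] at ha hb ⊢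
        rw [(isTwoAlgHom_comul k).map_mul,
          ((isTwoAlgHom_lift _).tensorMap (isTwoAlgHom_lift _)).map_mul, ha, hb,
          (isTwoAlgHom_lift _).map_mul, (isTwoAlgHom_comul k).map_mul]
    map_one' := lift_one _
    map_mul' := lift_mul _ }

theorem hom_ext {f g : TwoBialgHom k (FreeTwoAlgebra k V) A}
    (h : f.lin ∘ₗ ι k = g.lin ∘ₗ ι k) : f = g := by
  ext x
  change f.lin x = g.lin x
  induction x using FreeTwoAlgebra.induction with
  | of x => exact congr($h x)
  | one => exact f.map_one.trans g.map_one.symm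
  | add a b ha hb => rw [map_add, ha, hb, map_add]
  | smul c a ha => rw [map_smul, ha, map_smul]
  | mul i a b ha hb =>
    exact (f.map_mul i _ _).trans
      ((congrArg₂ (fun x y => mul k i x y) ha hb).trans (g.map_mul i _ _).symm)

instance [IsCocomm k V] : IsCocomm k (FreeTwoAlgebra k V) where
  comm_comp_comul := by
    ext a
    simp only [LinearMap.comp_apply, LinearEquiv.coe_coe]
    induction a using induction with
    | of x => rw [comul_ι, ← TensorProduct.map_comm, comm_comul]
    | one => rfl
    | add a b ha hb => rw [map_add, map_add, ha, hb]
    | smul c a ha => rw [map_smul, map_smul, ha]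
    | mul i a b ha hb =>
      rw [(isTwoAlgHom_comul k).map_mul]
      exact ((IsTwoAlgHom.tensorComm k _ _).map_mul i _ _).trans
        (congrArg₂ (fun s t => mul k i s t) ha hb)

end FreeTwoAlgebra

namespace TwoBialg

variable {I : Type u} (B : I → TwoBialg k)

open Classical in
/-- The map `toFreeOnSum` as a morphism of coalgebras. -/
def toFreeOnSumCoalgHom (t : I) : (B t).carrier →ₗc[k] (freeOnSum B).carrier :=
  (FreeTwoAlgebra.ιCoalgHom k (Π₀ l, (B l).carrier)).comp
    { DFinsupp.lsingle (R := k) (M := fun l => (B l).carrier) t with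
      counit_comp := DFinsupp.counit_comp_lsingle k I (fun l => (B l).carrier) t
      map_comp_comul := (DFinsupp.comul_comp_lsingle k I (fun l => (B l).carrier) t).symm }

theorem isCoideal_coproductRelations : (coproductRelations B).IsCoideal := by
  -- The product relations are values at pure tensors of the difference of two coalgebra maps on `B
  -- t ⊗ B t`; additivity extends membership in the span to all tensors.
  have hm (i : Fin 2) (t : I) (hi : ∀ x x' : (B t).carrier, toFreeOnSum B t (mul k i x x') -
      mul k i (toFreeOnSum B t x) (toFreeOnSum B t x') ∈ coproductRelations B)
      (c : (B t).carrier ⊗[k] (B t).carrier) :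
      ((toFreeOnSumCoalgHom B t).comp (TwoBialgebra.mulCoalgHom k (B t).carrier i)) c -
        ((TwoBialgebra.mulCoalgHom k (freeOnSum B).carrier i).comp
          (Coalgebra.TensorProduct.map (toFreeOnSumCoalgHom B t) (toFreeOnSumCoalgHom B t))) c ∈
      coproductRelations B := by
    induction c using TensorProduct.induction_on with
    | zero => simp
    | add c c' hc hc' => rw [map_add, map_add, add_sub_add_comm]; exact Submodule.add_mem _ hc hc'
    | tmul x x' => exact hi x x'
  refine isCoideal_span_of_coalgHom.{u, u, u} ?_
  rintro _ ((⟨t, rfl⟩ | ⟨t, x, x', rfl⟩) | ⟨t, x, x', rfl⟩)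
  -- The unit relation is the value at `1 : k` of the difference of two coalgebra maps on the base
  -- field.
  · refine ⟨k, _, _, _, TwoBialgebra.unitCoalgHom k _,
      (toFreeOnSumCoalgHom B t).comp (TwoBialgebra.unitCoalgHom k _), 1, ?_, fun c => ?_⟩
    · change _ = (1 : k) • _ - toFreeOnSum B t ((1 : k) • _)
      rw [one_smul, one_smul]
    · change c • _ - toFreeOnSum B t (c • _) ∈ _
      rw [map_smul, ← smul_sub]
      exact Submodule.smul_mem _ _ (Submodule.subset_span (Or.inl (Or.inl ⟨t, rfl⟩)))
  · exact ⟨_, _, _, _, _, _, x ⊗ₜ x', rfl, hm 0 t fun x x' =>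
      Submodule.subset_span (Or.inl (Or.inr ⟨t, x, x', rfl⟩))⟩
  · exact ⟨_, _, _, _, _, _, x ⊗ₜ x', rfl, hm 1 t fun x x' =>
      Submodule.subset_span (Or.inr ⟨t, x, x', rfl⟩)⟩

theorem isTwoBiideal_coproductIdeal : IsTwoBiideal (coproductIdeal B) :=
  isTwoBiideal_biidealClosure (isCoideal_coproductRelations B)

/-- The coproduct of a family of 2-bialgebras. -/
def coprod : TwoBialg k := (freeOnSum B).quotient _ (isTwoBiideal_coproductIdeal B)

/-- The canonical maps to the coproduct. -/
def coprodInj (t : I) : B t ⟶ coprod B :=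
  show TwoBialgHom k (B t).carrier (coprod B).carrier from
  { (TwoBialgHom.toCoalgHom ((freeOnSum B).proj _ (isTwoBiideal_coproductIdeal B))).comp
      (toFreeOnSumCoalgHom B t) with
    map_one' := by
      refine ((Submodule.Quotient.eq (coproductIdeal B)).2 ?_).symm
      exact le_biidealClosure _ (Submodule.subset_span (Or.inl (Or.inl ⟨t, rfl⟩)))
    map_mul' := fun i x x' => by
      refine (Submodule.Quotient.eq (coproductIdeal B)).2 (le_biidealClosure _ ?_)
      fin_cases i
      · exact Submodule.subset_span (Or.inl (Or.inr ⟨t, x, x', rfl⟩))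
      · exact Submodule.subset_span (Or.inr ⟨t, x, x', rfl⟩) }

variable {B} {C : TwoBialg k}

open Classical in
/-- The morphism of coalgebras from the direct sum induced by a family of morphisms. -/
def sumCoalgHom (f : ∀ l, B l ⟶ C) : (Π₀ l, (B l).carrier) →ₗc[k] C.carrier :=
  { DFinsupp.lsum k (fun l => TwoBialgHom.lin (f l)) with
    counit_comp := by
      ext l x
      simp
    map_comp_comul := by
      ext l x
      simp only [LinearMap.comp_apply, DFinsupp.lsingle_apply, DFinsupp.comul_single,
        TensorProduct.map_map, DFinsupp.lsum_single]
      refine Eq.trans ?_ (TwoBialgHom.comul_apply (f l) x).symm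
      congr 2 <;> (ext y; simp) }

open Classical in
/-- The morphism from the free 2-bialgebra on the direct sum induced by a family of morphisms. -/
def freeOnSumDesc (f : ∀ l, B l ⟶ C) : freeOnSum B ⟶ C := FreeTwoAlgebra.liftHom (sumCoalgHom f)

theorem freeOnSumDesc_apply (f : ∀ l, B l ⟶ C) (t : I) (x : (B t).carrier) :
    freeOnSumDesc f (toFreeOnSum B t x) = f t x := by
  classical
  exact DFinsupp.lsum_single (S := k) (fun l => TwoBialgHom.lin (f l)) t x

/-- The induced morphism restricts to `f t` on each summand, so preservation of the unit and
products by `f t` is exactly the vanishing of the relations; the kernel is stable under both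
multiplications. -/
theorem coproductIdeal_le_ker (f : ∀ l, B l ⟶ C) :
    coproductIdeal B ≤ LinearMap.ker (TwoBialgHom.lin (freeOnSumDesc f)) := by
  have hF (t : I) (x : (B t).carrier) :
      TwoBialgHom.lin (freeOnSumDesc f) (toFreeOnSum B t x) = TwoBialgHom.lin (f t) x :=
    freeOnSumDesc_apply f t x
  have hmul (i : Fin 2) (x y : (freeOnSum B).carrier) :
      TwoBialgHom.lin (freeOnSumDesc f) (mul k i x y) = mul k i
        (TwoBialgHom.lin (freeOnSumDesc f) x) (TwoBialgHom.lin (freeOnSumDesc f) y) :=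
    TwoBialgHom.map_mul (freeOnSumDesc f) i x y
  have hfmul (t : I) (i : Fin 2) (x y : (B t).carrier) :
      TwoBialgHom.lin (f t) (mul k i x y) = mul k i
        (TwoBialgHom.lin (f t) x) (TwoBialgHom.lin (f t) y) :=
    TwoBialgHom.map_mul (f t) i x y
  refine biidealClosure_le (Submodule.span_le.2 ?_) fun i a x hx => ?_
  · rintro _ ((⟨t, rfl⟩ | ⟨t, x, x', rfl⟩) | ⟨t, x, x', rfl⟩)
    · rw [SetLike.mem_coe, LinearMap.mem_ker, map_sub, hF, sub_eq_zero]
      exact (TwoBialgHom.map_one (freeOnSumDesc f)).trans (TwoBialgHom.map_one (f t)).symm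
    · rw [SetLike.mem_coe, LinearMap.mem_ker, map_sub, hmul, hF, hF, hF, hfmul, sub_self]
    · rw [SetLike.mem_coe, LinearMap.mem_ker, map_sub, hmul, hF, hF, hF, hfmul, sub_self]
  · rw [LinearMap.mem_ker] at hx
    rw [LinearMap.mem_ker, LinearMap.mem_ker, hmul, hmul, hx, map_zero, map_zero,
      LinearMap.zero_apply]
    exact ⟨rfl, rfl⟩

/-- The morphism from the coproduct induced by a family of morphisms. -/
def coprodDesc (f : ∀ l, B l ⟶ C) : coprod B ⟶ C :=
  desc _ (isTwoBiideal_coproductIdeal B) (freeOnSumDesc f) (coproductIdeal_le_ker f)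

theorem coprodInj_coprodDesc (f : ∀ l, B l ⟶ C) (t : I) : coprodInj B t ≫ coprodDesc f = f t :=
  TwoBialgHom.ext (freeOnSumDesc_apply f t)

theorem coprod_hom_ext {f g : coprod B ⟶ C} (h : ∀ t, coprodInj B t ≫ f = coprodInj B t ≫ g) :
    f = g := by
  classical
  refine quotient_hom_ext _ (isTwoBiideal_coproductIdeal B) (FreeTwoAlgebra.hom_ext ?_)
  refine DFinsupp.lhom_ext' fun t => LinearMap.ext fun x => ?_
  exact congr($(h t) x)

theorem isCocomm_coprod (hB : ∀ l, isCocomm k (B l)) : isCocomm k (coprod B) := by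
  classical
  have : ∀ l, IsCocomm k (B l).carrier := hB
  exact isCocomm_quotient _ (isTwoBiideal_coproductIdeal B)
    (inferInstanceAs (IsCocomm k (FreeTwoAlgebra k (Π₀ l, (B l).carrier))))

end TwoBialg

end CoproductOfBialgebras

variable {k : Type u} [Field k]

/-! ### Coequalizers and quotients by brace relations -/

namespace TwoHalg

section Coequalizer

variable {A B : TwoHalg k} (f g : A ⟶ B)

theorem isHopfBraceIdeal_coequalizer :
    IsHopfBraceIdeal (hopfIdealClosure (coequalizerRelations f g)) := by
  refine isHopfBraceIdeal_hopfIdealClosure ?_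
  -- The differences already form a subspace, the range of a linear map, so taking the span adds
  -- nothing.
  have : coequalizerRelations f g =
      LinearMap.range ((bialgHom f).lin - (bialgHom g).lin) :=
    Submodule.span_eq (LinearMap.range ((bialgHom f).lin - (bialgHom g).lin))
  rw [this]
  exact isCoideal_range_sub _ _

theorem comp_proj_coequalizer :
    f ≫ B.proj _ (isHopfBraceIdeal_coequalizer f g) =
      g ≫ B.proj _ (isHopfBraceIdeal_coequalizer f g) :=
  InducedCategory.hom_ext (TwoBialgHom.ext fun a =>
    (Submodule.Quotient.eq (hopfIdealClosure (coequalizerRelations f g))).2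
    (le_hopfIdealClosure _ (Submodule.subset_span ⟨a, rfl⟩)))

variable {f g}

theorem eq_zero_of_mem_coequalizerRelations {C : TwoHalg k} {h : B ⟶ C} (w : f ≫ h = g ≫ h)
    (x : B.carrier) (hx : x ∈ hopfIdealClosure (coequalizerRelations f g)) : h x = 0 := by
  refine hopfIdealClosure_le_ker h (fun x hx => ?_) hx
  have : coequalizerRelations f g ≤ LinearMap.ker (bialgHom h).lin := by
    refine Submodule.span_le.2 ?_
    rintro _ ⟨a, rfl⟩
    refine ((bialgHom h).lin.map_sub _ _).trans (sub_eq_zero.2 ?_)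
    exact congr(bialgHom $w a)
  exact this hx

end Coequalizer

section Coproduct

theorem isHopfBraceIdeal_braceRelations {I : Type u} {A : TwoHalg k} (hA : isCocomm k A)
    {C : I → TwoHalg k} (q : ∀ l, C l ⟶ A) {s : Set A.carrier} (hs : ∀ x, x ∈ s ↔ ∃ l y, q l y = x) :
    IsHopfBraceIdeal (hopfIdealClosure (braceRelations A s)) :=
  have : IsCocomm k A.carrier := hA
  isHopfBraceIdeal_hopfIdealClosure
    (isCoideal_span_braceRelations (fun l => (bialgHom (q l)).toCoalgHom) hs)

/-- Morphisms preserve both sides of the brace identity, which agree in `C`. Since `s` is arbitrary,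
both the full and the restricted quotient receive the induced morphisms. -/
theorem eq_zero_of_mem_braceRelations {A C : TwoHalg k} (hC : isHopfBrace k C) (f : A ⟶ C)
    (s : Set A.carrier) (x : A.carrier) (hx : x ∈ hopfIdealClosure (braceRelations A s)) :
    f x = 0 := by
  have : IsHopfBrace k C.carrier := hC
  refine hopfIdealClosure_le_ker f (fun x hx => ?_) hx
  have : braceRelations A s ≤ LinearMap.ker (bialgHom f).lin := by
    refine Submodule.span_le.2 ?_
    rintro _ ⟨x, -, y, -, z, -, rfl⟩
    refine ((bialgHom f).lin.map_sub _ _).trans (sub_eq_zero.2 ?_)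
    rw [TwoBialgHom.lin_apply, TwoBialgHom.lin_apply, TwoBialgHom.map_hopfBraceRHS,
      TwoBialgHom.map_mul, TwoBialgHom.map_mul, IsHopfBrace.brace]
  exact this hx

/-- Every triple in the quotient lifts to `A`, where its brace relation has been imposed; this is
where relations for all triples are needed. -/
theorem isHopfBrace_quotient_braceRelations {A : TwoHalg k}
    (hJ : IsHopfBraceIdeal (hopfIdealClosure (braceRelations A Set.univ))) :
    isHopfBrace k (A.quotient _ hJ) where
  brace x y z := by
    obtain ⟨x, rfl⟩ := proj_surjective _ hJ x
    obtain ⟨y, rfl⟩ := proj_surjective _ hJ y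
    obtain ⟨z, rfl⟩ := proj_surjective _ hJ z
    refine Eq.trans ?_ ((bialgHom (A.proj _ hJ)).map_hopfBraceRHS x y z)
    refine (Submodule.Quotient.eq _).2 (le_hopfIdealClosure _ (Submodule.subset_span ?_))
    exact ⟨x, trivial, y, trivial, z, trivial, rfl⟩

end Coproduct

end TwoHalg

instance : (TwoHalg.forget k).Full := inferInstanceAs (inducedFunctor TwoHalg.toTwoBialg).Full

instance : (TwoHalg.forget k).Faithful :=
  inferInstanceAs (inducedFunctor TwoHalg.toTwoBialg).Faithful

instance : (TwoHalgCoc.forget k).Full where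
  map_surjective f := ⟨ObjectProperty.homMk ((TwoHalg.forget k).preimage f.hom),
    ObjectProperty.hom_ext _ ((TwoHalg.forget k).map_preimage f.hom)⟩

instance : (TwoHalgCoc.forget k).Faithful where
  map_injective h :=
    ObjectProperty.hom_ext _ ((TwoHalg.forget k).map_injective congr(($h).hom))

/-- A universal arrow from a coproduct to a fully faithful functor defines a coproduct in the
source of that functor. -/
theorem exists_isColimit_of_isUniversal {C D : Type*} [Category* C] [Category* D] (G : D ⥤ C)
    [G.Full] [G.Faithful] {I : Type*} (H : I → D) (c : Cofan fun l => G.obj (H l))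
    (hc : IsColimit c) (K : D) (i : c.pt ⟶ G.obj K) (hi : (StructuredArrow.mk i).IsUniversal) :
    ∃ q : ∀ l, H l ⟶ K, (∀ l, G.map (q l) = c.inj l ≫ i) ∧
      Nonempty (IsColimit (Cofan.mk K q)) := by
  -- Fullness lifts the composite injections to the source category; faithfulness then lets the
  -- factorizations be verified after applying `G`.
  refine ⟨fun l => G.preimage (c.inj l ≫ i), fun l => G.map_preimage _, ⟨?_⟩⟩
  refine Cofan.IsColimit.mk _
    (fun s => hi.desc (StructuredArrow.mk (Y := s.pt)
      (Cofan.IsColimit.desc hc fun l => G.map (s.inj l)))) (fun s l => ?_) fun s m hm => ?_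
  · apply G.map_injective
    have h := hi.fac (StructuredArrow.mk (Y := s.pt)
      (Cofan.IsColimit.desc hc fun l => G.map (s.inj l)))
    refine ((G.map_comp _ _).trans (congrArg (· ≫ _) (G.map_preimage _))).trans ?_
    rw [Category.assoc]
    exact (congrArg (c.inj l ≫ ·) h).trans (Cofan.IsColimit.fac hc _ l)
  -- Morphisms out of `K` are determined after composition with `i`, and then on each summand of the
  -- coproduct.
  · refine hi.hom_ext (Eq.trans ?_ (hi.fac (StructuredArrow.mk (Y := s.pt)
      (Cofan.IsColimit.desc hc fun l => G.map (s.inj l)))).symm)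
    refine Cofan.IsColimit.hom_ext hc _ _ fun l => ?_
    refine Eq.trans ?_ (Cofan.IsColimit.fac hc _ l).symm
    have h := ((G.map_comp _ _).symm.trans (congrArg G.map (hm l)))
    refine Eq.trans ?_ h
    exact (Category.assoc _ _ _).symm.trans (congrArg (· ≫ _) (G.map_preimage _).symm)

/-! ### Morphisms from quotients of a coproduct to cocommutative Hopf braces -/

namespace HbrCoc

variable {I : Type u} {H : I → HbrCoc k} {c : Cofan fun l => (HbrCoc.incl k).obj (H l)}
  {s : Set c.pt.obj.carrier}
  (hc : IsColimit c) (hJ : IsHopfBraceIdeal (hopfIdealClosure (braceRelations c.pt.obj s)))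

/-- The morphism to a cocommutative Hopf brace from the quotient of the coproduct of 2-Hopf
algebras by brace relations. -/
def coprodDesc {B : HbrCoc k} (b : ∀ l, H l ⟶ B) : c.pt.obj.quotient _ hJ ⟶ B.obj :=
  TwoHalg.desc _ hJ (Cofan.IsColimit.desc hc fun l => (HbrCoc.incl k).map (b l)).hom
    (TwoHalg.eq_zero_of_mem_braceRelations B.property.1 _ s)

theorem inj_proj_coprodDesc {B : HbrCoc k} (b : ∀ l, H l ⟶ B) (l : I) :
    (c.inj l).hom ≫ c.pt.obj.proj _ hJ ≫ coprodDesc hc hJ b = (b l).hom :=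
  congr(($(Cofan.IsColimit.fac hc (fun l => (HbrCoc.incl k).map (b l)) l)).hom)

theorem quotient_hom_ext (hc : IsColimit c) {B : HbrCoc k} {f g : c.pt.obj.quotient _ hJ ⟶ B.obj}
    (h : ∀ l, (c.inj l).hom ≫ c.pt.obj.proj _ hJ ≫ f = (c.inj l).hom ≫ c.pt.obj.proj _ hJ ≫ g) :
    f = g := by
  refine TwoHalg.quotient_hom_ext _ hJ ?_
  -- The target is regarded as a cocommutative 2-Hopf algebra, the category in which `c` is a
  -- coproduct.
  have := Cofan.IsColimit.hom_ext hc
    (ObjectProperty.homMk (c.pt.obj.proj _ hJ ≫ f) : c.pt ⟶ (HbrCoc.incl k).obj B)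
    (ObjectProperty.homMk (c.pt.obj.proj _ hJ ≫ g))
    fun l => ObjectProperty.hom_ext _ (h l)
  exact congr(($this).hom)

end HbrCoc

end

theorem mainTheorem8 (k : Type u) [Field k] :
    -- coequalizers in `Hbr` and in `Hbr^coc`
    (∀ (A B : Hbr k) (f g : A ⟶ B),
      ∃ (hI : IsHopfBraceIdeal (hopfIdealClosure (coequalizerRelations f.hom g.hom)))
        (hQ : TwoHalg.isHopfBrace k (B.obj.quotient _ hI))
        (π : B ⟶ (⟨B.obj.quotient _ hI, hQ⟩ : Hbr k)) (w : f ≫ π = g ≫ π),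
        π.hom = B.obj.proj _ hI ∧ Nonempty (IsColimit (Cofork.ofπ π w))) ∧
    (∀ (A B : HbrCoc k) (f g : A ⟶ B),
      ∃ (hI : IsHopfBraceIdeal (hopfIdealClosure (coequalizerRelations f.hom g.hom)))
        (hQ : (TwoHalg.isHopfBrace k ⊓ TwoHalg.isCocomm k) (B.obj.quotient _ hI))
        (π : B ⟶ (⟨B.obj.quotient _ hI, hQ⟩ : HbrCoc k)) (w : f ≫ π = g ≫ π),
        π.hom = B.obj.proj _ hI ∧ Nonempty (IsColimit (Cofork.ofπ π w))) ∧
    -- coproducts of 2-bialgebras and of cocommutative 2-bialgebras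
    (∀ (I : Type u) (B : I → TwoBialg k),
      ∃ (hL : IsTwoBiideal (TwoBialg.coproductIdeal B))
        (q : ∀ l, B l ⟶ (TwoBialg.freeOnSum B).quotient _ hL),
        (∀ l (x : (B l).carrier),
          q l x = (TwoBialg.freeOnSum B).proj _ hL (TwoBialg.toFreeOnSum B l x)) ∧
        Nonempty (IsColimit (Cofan.mk _ q))) ∧
    (∀ (I : Type u) (B : I → TwoBialgCoc k),
      ∃ (hL : IsTwoBiideal (TwoBialg.coproductIdeal fun l => (B l).obj))
        (hQ : TwoBialg.isCocomm k ((TwoBialg.freeOnSum fun l => (B l).obj).quotient _ hL))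
        (q : ∀ l, B l ⟶
          (⟨(TwoBialg.freeOnSum fun l => (B l).obj).quotient _ hL, hQ⟩ : TwoBialgCoc k)),
        (∀ l (x : (B l).obj.carrier),
          (q l).hom x = (TwoBialg.freeOnSum fun l => (B l).obj).proj _ hL
            (TwoBialg.toFreeOnSum (fun l => (B l).obj) l x)) ∧
        Nonempty (IsColimit (Cofan.mk _ q))) ∧
    -- coproducts of 2-Hopf algebras and of cocommutative 2-Hopf algebras
    (TwoHalg.forget k).IsRightAdjoint ∧
    (∀ (I : Type u) (H : I → TwoHalg k) (c : Cofan fun l => (TwoHalg.forget k).obj (H l))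
      (_ : IsColimit c) (K : TwoHalg k) (i : c.pt ⟶ (TwoHalg.forget k).obj K)
      (_ : (StructuredArrow.mk i).IsUniversal),
      ∃ q : ∀ l, H l ⟶ K,
        (∀ l, (TwoHalg.forget k).map (q l) = c.inj l ≫ i) ∧
        Nonempty (IsColimit (Cofan.mk K q))) ∧
    (TwoHalgCoc.forget k).IsRightAdjoint ∧
    (∀ (I : Type u) (H : I → TwoHalgCoc k)
      (c : Cofan fun l => (TwoHalgCoc.forget k).obj (H l))
      (_ : IsColimit c) (K : TwoHalgCoc k) (i : c.pt ⟶ (TwoHalgCoc.forget k).obj K)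
      (_ : (StructuredArrow.mk i).IsUniversal),
      ∃ q : ∀ l, H l ⟶ K,
        (∀ l, (TwoHalgCoc.forget k).map (q l) = c.inj l ≫ i) ∧
        Nonempty (IsColimit (Cofan.mk K q))) ∧
    -- coproducts of cocommutative Hopf braces
    (∀ (I : Type u) (H : I → HbrCoc k) (c : Cofan fun l => (HbrCoc.incl k).obj (H l))
      (_ : IsColimit c),
      (∃ (hJ : IsHopfBraceIdeal (hopfIdealClosure (braceRelations c.pt.obj Set.univ)))
        (hQ : (TwoHalg.isHopfBrace k ⊓ TwoHalg.isCocomm k) (c.pt.obj.quotient _ hJ))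
        (s : ∀ l, H l ⟶ (⟨c.pt.obj.quotient _ hJ, hQ⟩ : HbrCoc k)),
        (∀ l, (s l).hom = (c.inj l).hom ≫ c.pt.obj.proj _ hJ) ∧
        Nonempty (IsColimit (Cofan.mk _ s))) ∧
      (∃ (hJ : IsHopfBraceIdeal (hopfIdealClosure (braceRelations c.pt.obj
          {x | ∃ (l : I) (y : (H l).obj.carrier), (c.inj l).hom y = x})))
        (_ : TwoHalg.isCocomm k (c.pt.obj.quotient _ hJ)),
        ∀ (B : HbrCoc k) (b : ∀ l, H l ⟶ B),
          ∃! w : c.pt.obj.quotient _ hJ ⟶ B.obj,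
            ∀ l, (c.inj l).hom ≫ c.pt.obj.proj _ hJ ≫ w = (b l).hom)) := by
  refine ⟨fun A B f g => ?_, fun A B f g => ?_, fun I B => ?_, fun I B => ?_,
    isRightAdjoint_forget, fun I H c hc K i hi => exists_isColimit_of_isUniversal _ H c hc K i hi,
    isRightAdjoint_forget_coc,
    fun I H c hc K i hi => exists_isColimit_of_isUniversal _ H c hc K i hi,
    fun I H c hc => ⟨?_, ?_⟩⟩
  · refine ⟨TwoHalg.isHopfBraceIdeal_coequalizer f.hom g.hom,
      TwoHalg.isHopfBrace_quotient _ _ B.property, ObjectProperty.homMk (B.obj.proj _ _),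
      ObjectProperty.hom_ext _ (TwoHalg.comp_proj_coequalizer f.hom g.hom), rfl, ⟨?_⟩⟩
    exact Cofork.IsColimit.mk _
      (fun s => ObjectProperty.homMk (TwoHalg.desc _ _ s.π.hom
        (TwoHalg.eq_zero_of_mem_coequalizerRelations congr(($s.condition).hom))))
      (fun s => ObjectProperty.hom_ext _ (TwoHalg.proj_desc _ _ _ _))
      fun s m hm => ObjectProperty.hom_ext _ (TwoHalg.quotient_hom_ext _ _
        (congr(($hm).hom).trans (TwoHalg.proj_desc _ _ _ _).symm))
  · refine ⟨TwoHalg.isHopfBraceIdeal_coequalizer f.hom g.hom,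
      ⟨TwoHalg.isHopfBrace_quotient _ _ B.property.1, TwoHalg.isCocomm_quotient _ _ B.property.2⟩,
      ObjectProperty.homMk (B.obj.proj _ _),
      ObjectProperty.hom_ext _ (TwoHalg.comp_proj_coequalizer f.hom g.hom), rfl, ⟨?_⟩⟩
    exact Cofork.IsColimit.mk _
      (fun s => ObjectProperty.homMk (TwoHalg.desc _ _ s.π.hom
        (TwoHalg.eq_zero_of_mem_coequalizerRelations congr(($s.condition).hom))))
      (fun s => ObjectProperty.hom_ext _ (TwoHalg.proj_desc _ _ _ _))
      fun s m hm => ObjectProperty.hom_ext _ (TwoHalg.quotient_hom_ext _ _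
        (congr(($hm).hom).trans (TwoHalg.proj_desc _ _ _ _).symm))
  · refine ⟨TwoBialg.isTwoBiideal_coproductIdeal B, TwoBialg.coprodInj B, fun l x => rfl, ⟨?_⟩⟩
    exact Cofan.IsColimit.mk _ (fun s => TwoBialg.coprodDesc s.inj)
      (fun s l => TwoBialg.coprodInj_coprodDesc _ l)
      fun s m hm => TwoBialg.coprod_hom_ext fun l =>
        (hm l).trans (TwoBialg.coprodInj_coprodDesc _ l).symm
  · refine ⟨TwoBialg.isTwoBiideal_coproductIdeal _,
      TwoBialg.isCocomm_coprod fun l => (B l).property,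
      fun l => ObjectProperty.homMk (TwoBialg.coprodInj (fun l => (B l).obj) l),
      fun l x => rfl, ⟨?_⟩⟩
    exact Cofan.IsColimit.mk _
      (fun s => ObjectProperty.homMk (TwoBialg.coprodDesc fun l => (s.inj l).hom))
      (fun s l => ObjectProperty.hom_ext _ (TwoBialg.coprodInj_coprodDesc _ l))
      fun s m hm => ObjectProperty.hom_ext _ (TwoBialg.coprod_hom_ext fun l =>
        congr(($(hm l)).hom).trans
          (TwoBialg.coprodInj_coprodDesc (fun l => (s.inj l).hom) l).symm)
  · have hJ : IsHopfBraceIdeal (hopfIdealClosure (braceRelations c.pt.obj Set.univ)) :=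
      -- The one-member family consisting of the identity has all of `c.pt.obj` as its union of
      -- images, which gives the unrestricted relations.
      TwoHalg.isHopfBraceIdeal_braceRelations c.pt.property (fun _ : PUnit.{u + 1} => 𝟙 c.pt.obj)
        fun x => ⟨fun _ => ⟨⟨⟩, x, rfl⟩, fun _ => trivial⟩
    refine ⟨hJ, ⟨TwoHalg.isHopfBrace_quotient_braceRelations hJ,
      TwoHalg.isCocomm_quotient _ hJ c.pt.property⟩,
      fun l => ObjectProperty.homMk ((c.inj l).hom ≫ c.pt.obj.proj _ hJ), fun l => rfl, ⟨?_⟩⟩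
    exact Cofan.IsColimit.mk _
      (fun s => ObjectProperty.homMk (HbrCoc.coprodDesc hc hJ s.inj))
      (fun s l => ObjectProperty.hom_ext _ (HbrCoc.inj_proj_coprodDesc hc hJ s.inj l))
      fun s m hm => ObjectProperty.hom_ext _ (HbrCoc.quotient_hom_ext hJ hc fun l =>
        congr(($(hm l)).hom).trans (HbrCoc.inj_proj_coprodDesc hc hJ s.inj l).symm)
  · have hJ : IsHopfBraceIdeal (hopfIdealClosure (braceRelations c.pt.obj
        {x | ∃ (l : I) (y : (H l).obj.carrier), (c.inj l).hom y = x})) :=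
      TwoHalg.isHopfBraceIdeal_braceRelations (C := fun l => (H l).obj) c.pt.property
        (fun l => (c.inj l).hom) fun x => Iff.rfl
    exact ⟨hJ, TwoHalg.isCocomm_quotient _ hJ c.pt.property, fun B b =>
      ⟨HbrCoc.coprodDesc hc hJ b, HbrCoc.inj_proj_coprodDesc hc hJ b, fun w hw =>
        HbrCoc.quotient_hom_ext hJ hc fun l =>
          (hw l).trans (HbrCoc.inj_proj_coprodDesc hc hJ b l).symm⟩⟩
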